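/- Let $\mathbb F$ be $\mathbb R$ or $\mathbb C$, let $1\le p<\infty$, and let $\mathbf w=(w_n)_{n=1}^\infty$ be a nonincreasing sequence of positive numbers with $w_1=1$, $\lim_n w_n=0$ and $\sum_n w_n=\infty$. Let $g(\mathbf w,p)$ be the Banach space of all scalar sequences $f=(a_n)_{n=1}^\infty\in\mathbb F^{\mathbb N}$ with $$\|f\|_g=\sup_{\phi}\Big(\sum_{n=1}^\infty |a_{\phi(n)}|^p\,w_n\Big)^{1/p}<\infty,$$ the supremum being over all strictly increasing functions $\phi\colon\mathbb N\to\mathbb N$. A basic sequence in a Banach space is a sequence that is a Schauder basis of its closed linear span. A basic sequence is called unconditional if each of its permutations is a basic sequence. Two basic sequences $(x_n)$, $(y_n)$, possibly in different spaces, are equivalent if there is $C>0$ with $\|\sum_n a_nx_n\|\le C\|\sum_n a_ny_n\|$ and $\|\sum_n a_ny_n\|\le C\|\sum_n a_nx_n\|$ for all finitely supported scalar sequences $(a_n)$. A basic sequence is called subsymmetric if it is unconditional and equivalent to each of its subsequences; a subsymmetric basis of a Banach space is a Schauder basis of it that is a subsymmetric basic sequence. **Theorem.** (a) If $(y_n)_{n=1}^\infty$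 is a subsymmetric basic sequence in $g(\mathbf w,p)$ and $Y$ is its closed linear span, then every subsymmetric basis of $Y$ is equivalent to $(y_n)_{n=1}^\infty$. (b) In particular, $g(\mathbf w,p)$ has a unique subsymmetric basis up to equivalence: the canonical unit vectors form a subsymmetric basis of $g(\mathbf w,p)$, and every subsymmetric basis of $g(\mathbf w,p)$ is equivalent to it. -/

import Mathlib

open scoped ENNReal

noncomputable section

/-! ### Schauder bases, basic sequences, equivalence, subsymmetry -/

section Basic

variable (𝕜 : Type*) [RCLike 𝕜]
variable {X : Type*} [NormedAddCommGroup X] [NormedSpace 𝕜 X]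
variable {Y : Type*} [NormedAddCommGroup Y] [NormedSpace 𝕜 Y]

/-- The sequence `x` is a (Schauder) basis for the whole space `X`. -/
def IsSchauderBasis (x : ℕ → X) : Prop :=
  ∃ b : SchauderBasis 𝕜 X, b.basis = x

/-- The closed linear span of a sequence. -/
def closedSpan (x : ℕ → X) : Submodule 𝕜 X :=
  (Submodule.span 𝕜 (Set.range x)).topologicalClosure

theorem mem_closedSpan (x : ℕ → X) (n : ℕ) : x n ∈ closedSpan 𝕜 x :=
  Submodule.le_topologicalClosure _ (Submodule.subset_span ⟨n, rfl⟩)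

/-- A basic sequence is a sequence that is a Schauder basis for its closed linear span. -/
def IsBasicSequence (x : ℕ → X) : Prop :=
  IsSchauderBasis 𝕜 (fun n => (⟨x n, mem_closedSpan 𝕜 x n⟩ : closedSpan 𝕜 x))

/-- `y` dominates `x` with constant `C`:
`‖∑ aₙ xₙ‖ ≤ C ‖∑ aₙ yₙ‖` for all finitely supported scalar sequences `a`. -/
def DominatesWith (C : ℝ) (y : ℕ → Y) (x : ℕ → X) : Prop :=
  ∀ a : ℕ →₀ 𝕜, ‖a.sum fun n c => c • x n‖ ≤ C * ‖a.sum fun n c => c • y n‖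

/-- Equivalence of sequences: each dominates the other. -/
def AreEquivalent (x : ℕ → X) (y : ℕ → Y) : Prop :=
  ∃ C : ℝ, 0 < C ∧ DominatesWith 𝕜 C y x ∧ DominatesWith 𝕜 C x y

/-- An unconditional basic sequence: all its rearrangements are basic sequences. -/
def IsUnconditionalBasic (x : ℕ → X) : Prop :=
  IsBasicSequence 𝕜 x ∧ ∀ σ : Equiv.Perm ℕ, IsBasicSequence 𝕜 (x ∘ σ)

/-- A subsymmetric basic sequence: unconditional, and equivalent to all its subsequences. -/
def IsSubsymmetricBasic (x : ℕ → X) : Prop :=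
  IsUnconditionalBasic 𝕜 x ∧ ∀ φ : ℕ → ℕ, StrictMono φ → AreEquivalent 𝕜 x (x ∘ φ)

/-- A subsymmetric basis for the whole space `X`. -/
def IsSubsymmetricBasis (x : ℕ → X) : Prop :=
  IsSchauderBasis 𝕜 x ∧ IsSubsymmetricBasic 𝕜 x

end Basic

/-! ### Garling sequence spaces -/

/-- The class `𝒲` of normalized, nonincreasing, positive weights in `c₀ \ ℓ₁`
(indexed from `0`). -/
structure GarlingWeight where
  val : ℕ → ℝ
  val_zero : val 0 = 1
  pos : ∀ n, 0 < val n
  antitone : Antitone val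
  tendsto_zero : Filter.Tendsto val Filter.atTop (nhds 0)
  not_summable : ¬ Summable val

section Garling

variable {𝕜 : Type*} [RCLike 𝕜]

/-- The extended Garling norm `sup_φ (∑ₙ |a_{φ(n)}|^p wₙ)^{1/p}`, over all increasing
`φ : ℕ → ℕ`. -/
def garlingENorm (w : GarlingWeight) (p : ℝ) (a : ℕ → 𝕜) : ℝ≥0∞ :=
  ⨆ (φ : ℕ → ℕ) (_ : StrictMono φ),
    (∑' n, ‖a (φ n)‖ₑ ^ p * ENNReal.ofReal (w.val n)) ^ (1 / p)

theorem ennreal_minkowski_tsum {p : ℝ} (hp : 1 ≤ p) (f g : ℕ → ℝ≥0∞) :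
    (∑' n, (f n + g n) ^ p) ^ (1 / p) ≤ (∑' n, f n ^ p) ^ (1 / p) + (∑' n, g n ^ p) ^ (1 / p) := by
  have hp0 : 0 < p := by linarith
  have key : ∑' n, (f n + g n) ^ p ≤
      ((∑' n, f n ^ p) ^ (1 / p) + (∑' n, g n ^ p) ^ (1 / p)) ^ p := by
    rw [ENNReal.tsum_eq_iSup_sum]
    refine iSup_le fun s => ?_
    have h := ENNReal.Lp_add_le s f g hp
    rw [one_div, ENNReal.rpow_inv_le_iff hp0, ← one_div] at h
    refine h.trans ?_
    gcongr <;> exact ENNReal.sum_le_tsum s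
  rwa [one_div, ENNReal.rpow_inv_le_iff hp0, ← one_div]

theorem garlingENorm_add_le (w : GarlingWeight) {p : ℝ} (hp : 1 ≤ p) (a b : ℕ → 𝕜) :
    garlingENorm w p (a + b) ≤ garlingENorm w p a + garlingENorm w p b := by
  have hp0 : 0 < p := by linarith
  refine iSup₂_le fun φ hφ => ?_
  have e : ∀ (x : ℝ≥0∞) n, x ^ p * ENNReal.ofReal (w.val n) =
      (x * ENNReal.ofReal (w.val n) ^ (1 / p)) ^ p := by
    intro x n
    rw [ENNReal.mul_rpow_of_nonneg _ _ hp0.le, ← ENNReal.rpow_mul, one_div_mul_cancel hp0.ne',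
      ENNReal.rpow_one]
  calc (∑' n, ‖(a + b) (φ n)‖ₑ ^ p * ENNReal.ofReal (w.val n)) ^ (1 / p)
      ≤ (∑' n, (‖a (φ n)‖ₑ * ENNReal.ofReal (w.val n) ^ (1 / p)
          + ‖b (φ n)‖ₑ * ENNReal.ofReal (w.val n) ^ (1 / p)) ^ p) ^ (1 / p) := by
        gcongr with n
        rw [e, ← add_mul]
        gcongr
        exact enorm_add_le _ _
    _ ≤ _ := ennreal_minkowski_tsum hp _ _
    _ ≤ _ := by
        simp only [← e]
        gcongr
        · exact le_iSup₂ (f := fun (φ : ℕ → ℕ) (_ : StrictMono φ) =>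
            (∑' n, ‖a (φ n)‖ₑ ^ p * ENNReal.ofReal (w.val n)) ^ (1 / p)) φ hφ
        · exact le_iSup₂ (f := fun (φ : ℕ → ℕ) (_ : StrictMono φ) =>
            (∑' n, ‖b (φ n)‖ₑ ^ p * ENNReal.ofReal (w.val n)) ^ (1 / p)) φ hφ

theorem garlingENorm_smul (w : GarlingWeight) {p : ℝ} (hp : 1 ≤ p) (c : 𝕜) (a : ℕ → 𝕜) :
    garlingENorm w p (c • a) = ‖c‖ₑ * garlingENorm w p a := by
  have hp0 : 0 < p := by linarith
  simp only [garlingENorm, ENNReal.mul_iSup]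
  refine iSup_congr fun φ => iSup_congr fun _ => ?_
  simp only [Pi.smul_apply, enorm_smul, ENNReal.mul_rpow_of_nonneg _ _ hp0.le, mul_assoc,
    ENNReal.tsum_mul_left]
  rw [ENNReal.mul_rpow_of_nonneg _ _ (by positivity), ← ENNReal.rpow_mul,
    mul_one_div_cancel hp0.ne', ENNReal.rpow_one]

theorem garlingENorm_zero (w : GarlingWeight) {p : ℝ} (hp : 1 ≤ p) :
    garlingENorm w p (0 : ℕ → 𝕜) = 0 := by
  simpa using garlingENorm_smul w hp (0 : 𝕜) (0 : ℕ → 𝕜)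

theorem enorm_le_garlingENorm (w : GarlingWeight) {p : ℝ} (hp : 1 ≤ p) (a : ℕ → 𝕜) (m : ℕ) :
    ‖a m‖ₑ ≤ garlingENorm w p a := by
  have hp0 : 0 < p := by linarith
  have hφ : StrictMono fun n => m + n := fun _ _ h => Nat.add_lt_add_left h m
  refine le_trans ?_ (le_iSup₂ (f := fun (φ : ℕ → ℕ) (_ : StrictMono φ) =>
    (∑' n, ‖a (φ n)‖ₑ ^ p * ENNReal.ofReal (w.val n)) ^ (1 / p)) _ hφ)
  rw [one_div, ENNReal.le_rpow_inv_iff hp0]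
  refine le_trans ?_ (ENNReal.le_tsum 0)
  simp [w.val_zero]

theorem garlingENorm_single_le (w : GarlingWeight) {p : ℝ} (hp : 1 ≤ p) (m : ℕ) :
    garlingENorm w p (Pi.single m 1 : ℕ → 𝕜) ≤ 1 := by
  have hp0 : 0 < p := by linarith
  refine iSup₂_le fun φ hφ => ?_
  rw [one_div, ENNReal.rpow_inv_le_iff hp0, ENNReal.one_rpow]
  by_cases h : ∃ k, φ k = m
  · obtain ⟨k, rfl⟩ := h
    rw [tsum_eq_single k]
    · have : w.val k ≤ 1 := by simpa [w.val_zero] using w.antitone (Nat.zero_le k)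
      simpa using this
    · intro n hn
      have : φ n ≠ φ k := fun h => hn (hφ.injective h)
      simp [Pi.single_eq_of_ne this, hp0]
  · push Not at h
    simp [Pi.single_eq_of_ne (h _), hp0]

end Garling

/-- The sequences with finite Garling norm, as a subspace of `𝕜^ℕ`. -/
def garlingSubmodule (𝕜 : Type*) [RCLike 𝕜] (w : GarlingWeight) (p : ℝ) [hp : Fact (1 ≤ p)] :
    Submodule 𝕜 (ℕ → 𝕜) where
  carrier := {a | garlingENorm w p a < ∞}
  add_mem' {a b} ha hb :=
    (garlingENorm_add_le w hp.out a b).trans_lt (ENNReal.add_lt_top.2 ⟨ha, hb⟩)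
  zero_mem' := by
    change garlingENorm w p 0 < ∞
    rw [garlingENorm_zero w hp.out]; exact ENNReal.zero_lt_top
  smul_mem' c a ha := by
    change garlingENorm w p (c • a) < ∞
    rw [garlingENorm_smul w hp.out]; exact ENNReal.mul_lt_top enorm_lt_top ha

/-- The Garling sequence space `g(w, p)`. It is a type of its own (not reducible to a subspace
of `𝕜^ℕ`), so that it carries the topology of its norm and not that of pointwise convergence. -/
def GarlingSpace (𝕜 : Type*) [RCLike 𝕜] (w : GarlingWeight) (p : ℝ) [Fact (1 ≤ p)] : Type _ :=
  ↥(garlingSubmodule 𝕜 w p)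

namespace GarlingSpace

variable {𝕜 : Type*} [RCLike 𝕜] {w : GarlingWeight} {p : ℝ} [hp : Fact (1 ≤ p)]

instance instAddCommGroup : AddCommGroup (GarlingSpace 𝕜 w p) :=
  inferInstanceAs (AddCommGroup ↥(garlingSubmodule 𝕜 w p))

instance instModule : Module 𝕜 (GarlingSpace 𝕜 w p) :=
  inferInstanceAs (Module 𝕜 ↥(garlingSubmodule 𝕜 w p))

/-- The underlying scalar sequence. -/
def toSeq (f : GarlingSpace 𝕜 w p) : ℕ → 𝕜 := Subtype.val f

instance instNorm : Norm (GarlingSpace 𝕜 w p) := ⟨fun f => (garlingENorm w p f.toSeq).toReal⟩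

theorem normedSpaceCore : NormedSpace.Core 𝕜 (GarlingSpace 𝕜 w p) where
  norm_nonneg _ := ENNReal.toReal_nonneg
  norm_smul c f := by
    change (garlingENorm w p (c • f.toSeq)).toReal = ‖c‖ * (garlingENorm w p f.toSeq).toReal
    rw [garlingENorm_smul w hp.out, ENNReal.toReal_mul, toReal_enorm]
  norm_triangle f g := by
    change (garlingENorm w p (f.toSeq + g.toSeq)).toReal ≤
      (garlingENorm w p f.toSeq).toReal + (garlingENorm w p g.toSeq).toReal
    have hf : garlingENorm w p f.toSeq < ∞ := Subtype.property f
    have hg : garlingENorm w p g.toSeq < ∞ := Subtype.property g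
    rw [← ENNReal.toReal_add hf.ne hg.ne]
    exact ENNReal.toReal_mono (ENNReal.add_lt_top.2 ⟨hf, hg⟩).ne
      (garlingENorm_add_le w hp.out _ _)
  norm_eq_zero_iff f := by
    change (garlingENorm w p f.toSeq).toReal = 0 ↔ f = 0
    have hf : garlingENorm w p f.toSeq < ∞ := Subtype.property f
    rw [ENNReal.toReal_eq_zero_iff, or_iff_left hf.ne]
    constructor
    · intro h
      refine Subtype.ext (funext fun m => ?_)
      have h1 := enorm_le_garlingENorm w hp.out f.toSeq m
      rw [h, nonpos_iff_eq_zero, enorm_eq_zero] at h1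
      exact h1
    · rintro rfl
      exact garlingENorm_zero w hp.out

instance instNormedAddCommGroup : NormedAddCommGroup (GarlingSpace 𝕜 w p) :=
  NormedAddCommGroup.ofCore (𝕜 := 𝕜) normedSpaceCore

instance instNormedSpace : NormedSpace 𝕜 (GarlingSpace 𝕜 w p) :=
  NormedSpace.ofCore normedSpaceCore

/-- The canonical unit vectors of `g(w, p)`. -/
def unitVec (𝕜 : Type*) [RCLike 𝕜] (w : GarlingWeight) (p : ℝ) [hp : Fact (1 ≤ p)] (n : ℕ) :
    GarlingSpace 𝕜 w p :=
  ⟨Pi.single n 1, (garlingENorm_single_le w hp.out n).trans_lt ENNReal.one_lt_top⟩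

end GarlingSpace

end

/-! Let `x` and `y` be two subsymmetric bases of the same subspace of a Garling space. The argument
compares them by writing one as blocks of the other.

First, unconditionality, given through permutations, is turned into an inequality: shrinking
coefficients costs at most a constant factor (`IsUnconditionalBasic.exists_unconditionalWith`).
Equivalence with all subsequences forces the norms to be bounded above and below
(`seminormalized_of_subsequences`).

Next, a subsymmetric sequence is equivalent to a block sequence of any Schauder basis of a space
containing it (`SchauderBasis.exists_equivalent_blocks`). A subsequence has convergent coordinates,
so its consecutive differences have null coordinates and a gliding hump applies; by subsymmetry and
unconditionality these differences are still equivalent to the original sequence.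

Now write `y` as blocks of `x`. If the block coefficients do not tend uniformly to zero, keeping one
large coefficient in each of infinitely many blocks shows that a subsequence of `y` dominates a
subsequence of `x`, hence `y` dominates `x`. If they do tend uniformly to zero, write `x` in turn as
blocks of the unit vectors of the Garling space. Then `y` becomes a block sequence of the unit
vectors with uniformly null coefficients, and such a sequence has a subsequence equivalent to the
`ℓ_p` basis (`GarlingSpace.exists_subseq_isLpSequence`): very flat late blocks can be appended to a
test set while losing only a few small terms. So `y` is equivalent to the `ℓ_p` basis, and then so
is `x`, being equivalent to a seminormalized block sequence of `y`.

Exchanging the roles, either both dominate each other or both are `ℓ_p` bases; they are equivalent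
in either case. -/

noncomputable section

/-! ### Domination of sequences -/

section Domination

variable {𝕜 : Type*} [RCLike 𝕜]
variable {X : Type*} [NormedAddCommGroup X] [NormedSpace 𝕜 X]
variable {Y : Type*} [NormedAddCommGroup Y] [NormedSpace 𝕜 Y]
variable {Z : Type*} [NormedAddCommGroup Z] [NormedSpace 𝕜 Z]

variable (𝕜) in
/-- `y` dominates `x` with some constant. -/
def Dominates (y : ℕ → Y) (x : ℕ → X) : Prop :=
  ∃ C : ℝ, 0 < C ∧ ∀ a : ℕ →₀ 𝕜,
    ‖Finsupp.linearCombination 𝕜 x a‖ ≤ C * ‖Finsupp.linearCombination 𝕜 y a‖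

theorem areEquivalent_iff_dominates {x : ℕ → X} {y : ℕ → Y} :
    AreEquivalent 𝕜 x y ↔ Dominates 𝕜 y x ∧ Dominates 𝕜 x y := by
  constructor
  · rintro ⟨C, hC, h1, h2⟩
    exact ⟨⟨C, hC, h1⟩, ⟨C, hC, h2⟩⟩
  · rintro ⟨⟨C, hC, h1⟩, ⟨D, hD, h2⟩⟩
    refine ⟨max C D, lt_max_of_lt_left hC, fun a => (h1 a).trans ?_, fun a => (h2 a).trans ?_⟩
    · exact mul_le_mul_of_nonneg_right (le_max_left _ _) (norm_nonneg _)
    · exact mul_le_mul_of_nonneg_right (le_max_right _ _) (norm_nonneg _)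

theorem Dominates.trans {x : ℕ → X} {y : ℕ → Y} {z : ℕ → Z}
    (h1 : Dominates 𝕜 x y) (h2 : Dominates 𝕜 y z) : Dominates 𝕜 x z := by
  obtain ⟨C, hC, h1⟩ := h1
  obtain ⟨D, hD, h2⟩ := h2
  refine ⟨D * C, mul_pos hD hC, fun a => (h2 a).trans ?_⟩
  rw [mul_assoc]
  exact mul_le_mul_of_nonneg_left (h1 a) hD.le

theorem linearCombination_comp (x : ℕ → X) (ψ : ℕ → ℕ) (a : ℕ →₀ 𝕜) :
    Finsupp.linearCombination 𝕜 (x ∘ ψ) a =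
      Finsupp.linearCombination 𝕜 x (Finsupp.mapDomain ψ a) :=
  (Finsupp.linearCombination_mapDomain 𝕜 ψ a).symm

theorem linearCombination_blocks (x : ℕ → X) (β : ℕ → ℕ →₀ 𝕜) (a : ℕ →₀ 𝕜) :
    Finsupp.linearCombination 𝕜 (fun n => Finsupp.linearCombination 𝕜 x (β n)) a =
      Finsupp.linearCombination 𝕜 x (Finsupp.linearCombination 𝕜 β a) := by
  rw [Finsupp.apply_linearCombination]
  rfl

theorem Dominates.comp {x : ℕ → X} {y : ℕ → Y} (h : Dominates 𝕜 x y) (ψ : ℕ → ℕ) :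
    Dominates 𝕜 (x ∘ ψ) (y ∘ ψ) := by
  obtain ⟨C, hC, h⟩ := h
  refine ⟨C, hC, fun a => ?_⟩
  rw [linearCombination_comp, linearCombination_comp]
  exact h _

theorem Dominates.blocks {x : ℕ → X} {y : ℕ → Y} (h : Dominates 𝕜 x y) (β : ℕ → ℕ →₀ 𝕜) :
    Dominates 𝕜 (fun n => Finsupp.linearCombination 𝕜 x (β n))
      (fun n => Finsupp.linearCombination 𝕜 y (β n)) := by
  obtain ⟨C, hC, h⟩ := h
  refine ⟨C, hC, fun a => ?_⟩
  rw [linearCombination_blocks, linearCombination_blocks]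
  exact h _

theorem AreEquivalent.symm {x : ℕ → X} {y : ℕ → Y} (h : AreEquivalent 𝕜 x y) :
    AreEquivalent 𝕜 y x := by
  obtain ⟨C, hC, h1, h2⟩ := h
  exact ⟨C, hC, h2, h1⟩

theorem AreEquivalent.trans {x : ℕ → X} {y : ℕ → Y} {z : ℕ → Z}
    (h1 : AreEquivalent 𝕜 x y) (h2 : AreEquivalent 𝕜 y z) : AreEquivalent 𝕜 x z := by
  rw [areEquivalent_iff_dominates] at *
  exact ⟨h2.1.trans h1.1, h1.2.trans h2.2⟩

theorem AreEquivalent.comp {x : ℕ → X} {y : ℕ → Y} (h : AreEquivalent 𝕜 x y) (ψ : ℕ → ℕ) :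
    AreEquivalent 𝕜 (x ∘ ψ) (y ∘ ψ) := by
  rw [areEquivalent_iff_dominates] at *
  exact ⟨h.1.comp ψ, h.2.comp ψ⟩

theorem AreEquivalent.blocks {x : ℕ → X} {y : ℕ → Y} (h : AreEquivalent 𝕜 x y)
    (β : ℕ → ℕ →₀ 𝕜) :
    AreEquivalent 𝕜 (fun n => Finsupp.linearCombination 𝕜 x (β n))
      (fun n => Finsupp.linearCombination 𝕜 y (β n)) := by
  rw [areEquivalent_iff_dominates] at *
  exact ⟨h.1.blocks β, h.2.blocks β⟩

theorem Dominates.norm_le {x : ℕ → X} {y : ℕ → Y} (h : Dominates 𝕜 y x) :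
    ∃ C : ℝ, 0 < C ∧ ∀ n, ‖x n‖ ≤ C * ‖y n‖ := by
  obtain ⟨C, hC, h⟩ := h
  exact ⟨C, hC, fun n => by simpa using h (Finsupp.single n 1)⟩

/-- The norms of the terms are bounded, and bounded away from zero. -/
def Seminormalized (x : ℕ → X) : Prop :=
  ∃ δ M : ℝ, 0 < δ ∧ 0 < M ∧ ∀ n, δ ≤ ‖x n‖ ∧ ‖x n‖ ≤ M

theorem Seminormalized.of_areEquivalent {x : ℕ → X} {y : ℕ → Y} (hx : Seminormalized x)
    (h : AreEquivalent 𝕜 x y) : Seminormalized y := by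
  obtain ⟨δ, M, hδ, hM, hx⟩ := hx
  rw [areEquivalent_iff_dominates] at h
  obtain ⟨C, hC, h1⟩ := h.1.norm_le
  obtain ⟨D, hD, h2⟩ := h.2.norm_le
  refine ⟨δ / C, D * M, by positivity, by positivity, fun n => ⟨?_, ?_⟩⟩
  · rw [div_le_iff₀' hC]
    exact (hx n).1.trans (h1 n)
  · exact (h2 n).trans (mul_le_mul_of_nonneg_left (hx n).2 hD.le)

/-- A sequence of nonzero vectors equivalent to all its subsequences is seminormalized. -/
theorem seminormalized_of_subsequences {x : ℕ → X} (hx0 : ∀ n, x n ≠ 0)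
    (h : ∀ φ : ℕ → ℕ, StrictMono φ → AreEquivalent 𝕜 x (x ∘ φ)) : Seminormalized x := by
  have hpos : ∀ n, 0 < ‖x n‖ := fun n => norm_pos_iff.2 (hx0 n)
  have low : ∃ δ : ℝ, 0 < δ ∧ ∀ n, δ ≤ ‖x n‖ := by
    by_contra! hcon
    -- A term smaller than the minimum over the first `N + 1` terms must come later. The extracted
    -- subsequence shrinks the `n`-th norm by more than `n + 1`, which no constant of equivalence
    -- allows.
    have hfreq : ∀ n : ℕ, ∃ᶠ k in Filter.atTop, ‖x k‖ * (n + 1) < ‖x n‖ := by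
      intro n
      rw [Filter.frequently_atTop]
      intro N
      have hne : (insert n (Finset.range (N + 1))).Nonempty := ⟨n, by simp⟩
      obtain ⟨m, -, hm⟩ := Finset.exists_min_image (insert n (Finset.range (N + 1)))
        (fun k => ‖x k‖) hne
      obtain ⟨k, hk⟩ := hcon (‖x m‖ / (n + 1)) (div_pos (hpos m) (by positivity))
      have hn1 : (0 : ℝ) < n + 1 := by positivity
      rw [lt_div_iff₀ hn1] at hk
      refine ⟨k, ?_, hk.trans_le (hm n (by simp))⟩
      by_contra! hkN
      have h1 := hm k (by simp; omega)
      have h2 : ‖x k‖ ≤ ‖x k‖ * (n + 1) := by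
        have : (0 : ℝ) ≤ n := by positivity
        nlinarith [hpos k]
      linarith
    obtain ⟨φ, hφ, hφ'⟩ := Filter.extraction_forall_of_frequently hfreq
    obtain ⟨C, hC, hC'⟩ := (areEquivalent_iff_dominates.1 (h φ hφ)).1.norm_le
    obtain ⟨n, hn⟩ := exists_nat_gt C
    have h1 := hC' n
    have h2 := hφ' n
    have h3 := hpos (φ n)
    simp only [Function.comp] at h1
    nlinarith
  have up : ∃ M : ℝ, 0 < M ∧ ∀ n, ‖x n‖ ≤ M := by
    by_contra! hcon
    have hfreq : ∀ n : ℕ, ∃ᶠ k in Filter.atTop, ‖x n‖ * (n + 1) < ‖x k‖ := by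
      intro n
      rw [Filter.frequently_atTop]
      intro N
      have hne : (insert n (Finset.range (N + 1))).Nonempty := ⟨n, by simp⟩
      obtain ⟨m, -, hm⟩ := Finset.exists_max_image (insert n (Finset.range (N + 1)))
        (fun k => ‖x k‖) hne
      have hn1 : (0 : ℝ) < n + 1 := by positivity
      obtain ⟨k, hk⟩ := hcon (‖x m‖ * (n + 1)) (mul_pos (hpos m) hn1)
      refine ⟨k, ?_, (mul_le_mul_of_nonneg_right (hm n (by simp)) hn1.le).trans_lt hk⟩
      by_contra! hkN
      have h1 := hm k (by simp; omega)
      have : (0 : ℝ) ≤ n := by positivity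
      nlinarith [hpos m]
    obtain ⟨φ, hφ, hφ'⟩ := Filter.extraction_forall_of_frequently hfreq
    obtain ⟨C, hC, hC'⟩ := (areEquivalent_iff_dominates.1 (h φ hφ)).2.norm_le
    obtain ⟨n, hn⟩ := exists_nat_gt C
    have h1 := hC' n
    have h2 := hφ' n
    have h3 := hpos n
    simp only [Function.comp] at h1
    nlinarith
  obtain ⟨δ, hδ, h1⟩ := low
  obtain ⟨M, hM, h2⟩ := up
  exact ⟨δ, M, hδ, hM, fun n => ⟨h1 n, h2 n⟩⟩

variable (𝕜) in
/-- Shrinking the coefficients increases the norm by a factor of at most `K`. -/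
def UnconditionalWith (K : ℝ) (x : ℕ → X) : Prop :=
  ∀ a b : ℕ →₀ 𝕜, (∀ n, ‖a n‖ ≤ ‖b n‖) →
    ‖Finsupp.linearCombination 𝕜 x a‖ ≤ K * ‖Finsupp.linearCombination 𝕜 x b‖

theorem UnconditionalWith.norm_coeff_mul_le {K : ℝ} {x : ℕ → X} (h : UnconditionalWith 𝕜 K x)
    (a : ℕ →₀ 𝕜) (n : ℕ) : ‖a n‖ * ‖x n‖ ≤ K * ‖Finsupp.linearCombination 𝕜 x a‖ := by
  have := h (Finsupp.single n (a n)) a fun m => by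
    by_cases hm : n = m
    · subst hm; simp
    · simp [Finsupp.single_eq_of_ne' hm]
  simpa [norm_smul] using this

/-- A small perturbation of a sequence with bounded coefficient functionals. -/
theorem areEquivalent_of_perturbation {s t : ℕ → X} {L : ℝ} {ε : ℕ → ℝ}
    (hL : ∀ (a : ℕ →₀ 𝕜) n, ‖a n‖ ≤ L * ‖Finsupp.linearCombination 𝕜 s a‖)
    (hst : ∀ n, ‖s n - t n‖ ≤ ε n) (hsum : ∀ A : Finset ℕ, L * ∑ n ∈ A, ε n ≤ 1 / 2) :
    AreEquivalent 𝕜 s t := by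
  have key : ∀ a : ℕ →₀ 𝕜, ‖Finsupp.linearCombination 𝕜 s a - Finsupp.linearCombination 𝕜 t a‖ ≤
      1 / 2 * ‖Finsupp.linearCombination 𝕜 s a‖ := by
    intro a
    rw [Finsupp.linearCombination_apply, Finsupp.linearCombination_apply, Finsupp.sum, Finsupp.sum,
      ← Finset.sum_sub_distrib]
    calc ‖∑ n ∈ a.support, (a n • s n - a n • t n)‖
        ≤ ∑ n ∈ a.support, (L * ‖Finsupp.linearCombination 𝕜 s a‖) * ε n := by
          refine (norm_sum_le _ _).trans (Finset.sum_le_sum fun n _ => ?_)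
          rw [← smul_sub, norm_smul]
          exact mul_le_mul (hL a n) (hst n) (norm_nonneg _) ((norm_nonneg _).trans (hL a n))
      _ = (L * ∑ n ∈ a.support, ε n) * ‖Finsupp.linearCombination 𝕜 s a‖ := by
          rw [← Finset.mul_sum]; ring
      _ ≤ _ := mul_le_mul_of_nonneg_right (hsum _) (norm_nonneg _)
  refine ⟨2, two_pos, fun a => ?_, fun a => ?_⟩
  · change ‖Finsupp.linearCombination 𝕜 s a‖ ≤ 2 * ‖Finsupp.linearCombination 𝕜 t a‖
    have h1 := key a
    have h2 := norm_sub_norm_le (Finsupp.linearCombination 𝕜 s a) (Finsupp.linearCombination 𝕜 t a)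
    linarith
  · change ‖Finsupp.linearCombination 𝕜 t a‖ ≤ 2 * ‖Finsupp.linearCombination 𝕜 s a‖
    have h1 := key a
    have h2 := norm_sub_norm_le (Finsupp.linearCombination 𝕜 t a) (Finsupp.linearCombination 𝕜 s a)
    rw [norm_sub_rev] at h2
    have := norm_nonneg (Finsupp.linearCombination 𝕜 s a)
    linarith

/-- The differences of consecutive terms of a subsequence are equivalent to the sequence. -/
theorem areEquivalent_differences {K : ℝ} (hK : 0 < K) {x : ℕ → X} (hu : UnconditionalWith 𝕜 K x)
    (hs : ∀ φ : ℕ → ℕ, StrictMono φ → AreEquivalent 𝕜 x (x ∘ φ)) {φ : ℕ → ℕ}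
    (hφ : StrictMono φ) :
    AreEquivalent 𝕜 x (fun n => x (φ (2 * n)) - x (φ (2 * n + 1))) := by
  have m0 : StrictMono fun n => φ (2 * n) := fun a b h => hφ (by omega)
  have m1 : StrictMono fun n => φ (2 * n + 1) := fun a b h => hφ (by omega)
  have split : ∀ a : ℕ →₀ 𝕜,
      Finsupp.linearCombination 𝕜 (fun n => x (φ (2 * n)) - x (φ (2 * n + 1))) a =
      Finsupp.linearCombination 𝕜 (x ∘ fun n => φ (2 * n)) a -
      Finsupp.linearCombination 𝕜 (x ∘ fun n => φ (2 * n + 1)) a := by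
    intro a
    simp only [Finsupp.linearCombination_apply, Finsupp.sum, ← Finset.sum_sub_distrib, smul_sub,
      Function.comp]
  obtain ⟨C, hC, h1, h2⟩ := hs _ m0
  obtain ⟨D, hD, h3, h4⟩ := hs _ m1
  rw [areEquivalent_iff_dominates]
  constructor
  · refine ⟨C * K, by positivity, fun a => (h1 a).trans ?_⟩
    rw [mul_assoc]
    refine mul_le_mul_of_nonneg_left ?_ hC.le
    change ‖Finsupp.linearCombination 𝕜 (x ∘ fun n => φ (2 * n)) a‖ ≤ _
    -- The even-indexed and odd-indexed terms occupy disjoint positions, so unconditionality allows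
    -- the odd ones to be discarded.
    rw [split, linearCombination_comp, linearCombination_comp, ← map_sub]
    refine hu _ _ fun k => ?_
    rw [Finsupp.sub_apply]
    by_cases hk : ∃ n, φ (2 * n) = k
    · obtain ⟨n, rfl⟩ := hk
      have : (Finsupp.mapDomain (fun n => φ (2 * n + 1)) a) (φ (2 * n)) = 0 := by
        refine Finsupp.mapDomain_of_notMem_range _ _ ?_
        rintro ⟨m, hm⟩
        have := hφ.injective hm
        omega
      rw [this, sub_zero]
    · rw [Finsupp.mapDomain_of_notMem_range a k fun h => hk h]
      simp
  · refine ⟨C + D, by positivity, fun a => ?_⟩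
    rw [split, add_mul]
    exact (norm_sub_le _ _).trans (add_le_add (h2 a) (h4 a))

end Domination

/-! ### Block sequences -/

section Blocks

variable {𝕜 : Type*} [RCLike 𝕜]

/-- The supports of the `β n` lie in the successive intervals `[N n, N (n + 1))`. -/
def IsBlockSequence (N : ℕ → ℕ) (β : ℕ → ℕ →₀ 𝕜) : Prop :=
  StrictMono N ∧ ∀ n k, β n k ≠ 0 → N n ≤ k ∧ k < N (n + 1)

theorem StrictMono.eq_of_mem_Ico {N : ℕ → ℕ} (hN : StrictMono N) {m n k : ℕ}
    (hm : N m ≤ k ∧ k < N (m + 1)) (hn : N n ≤ k ∧ k < N (n + 1)) : m = n := by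
  have h1 : m < n + 1 := hN.lt_iff_lt.1 (hm.1.trans_lt hn.2)
  have h2 : n < m + 1 := hN.lt_iff_lt.1 (hn.1.trans_lt hm.2)
  omega

theorem IsBlockSequence.linearCombination_apply {N : ℕ → ℕ} {β : ℕ → ℕ →₀ 𝕜}
    (h : IsBlockSequence N β) (a : ℕ →₀ 𝕜) {n k : ℕ} (hk : N n ≤ k ∧ k < N (n + 1)) :
    Finsupp.linearCombination 𝕜 β a k = a n * β n k := by
  rw [Finsupp.linearCombination_apply, Finsupp.sum, Finsupp.finsetSum_apply]
  rw [Finset.sum_eq_single n]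
  · simp
  · intro m _ hmn
    have : β m k = 0 := by
      by_contra h0
      exact hmn (h.1.eq_of_mem_Ico (h.2 m k h0) hk)
    simp [this]
  · intro hn
    simp [Finsupp.notMem_support_iff.1 hn]

theorem IsBlockSequence.exists_mem_of_ne_zero {N : ℕ → ℕ} {β : ℕ → ℕ →₀ 𝕜}
    (h : IsBlockSequence N β) (a : ℕ →₀ 𝕜) {k : ℕ}
    (hk : Finsupp.linearCombination 𝕜 β a k ≠ 0) :
    ∃ n ∈ a.support, N n ≤ k ∧ k < N (n + 1) := by
  rw [Finsupp.linearCombination_apply, Finsupp.sum, Finsupp.finsetSum_apply] at hk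
  obtain ⟨n, hn, h0⟩ := Finset.exists_ne_zero_of_sum_ne_zero hk
  exact ⟨n, hn, h.2 n k fun h1 => h0 (by simp [h1])⟩

theorem IsBlockSequence.blocks {N M : ℕ → ℕ} {β γ : ℕ → ℕ →₀ 𝕜}
    (hβ : IsBlockSequence N β) (hγ : IsBlockSequence M γ) :
    IsBlockSequence (M ∘ N) (fun n => Finsupp.linearCombination 𝕜 γ (β n)) := by
  refine ⟨hγ.1.comp hβ.1, fun n k hk => ?_⟩
  obtain ⟨m, hm, h1, h2⟩ := hγ.exists_mem_of_ne_zero _ hk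
  obtain ⟨h3, h4⟩ := hβ.2 n m (Finsupp.mem_support_iff.1 hm)
  exact ⟨(hγ.1.monotone h3).trans h1, h2.trans_le (hγ.1.monotone h4)⟩

/-- The `p`-th power of the `ℓ_p` norm. -/
def lpSum (p : ℝ) (a : ℕ →₀ 𝕜) : ℝ := a.sum fun _ c => ‖c‖ ^ p

theorem lpSum_nonneg (p : ℝ) (a : ℕ →₀ 𝕜) : 0 ≤ lpSum p a :=
  Finset.sum_nonneg fun _ _ => Real.rpow_nonneg (norm_nonneg _) _

theorem lpSum_smul {p : ℝ} (hp : 0 < p) (c : 𝕜) (a : ℕ →₀ 𝕜) :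
    lpSum p (c • a) = ‖c‖ ^ p * lpSum p a := by
  rw [lpSum, Finsupp.sum_smul_index (by simp [Real.zero_rpow hp.ne']), lpSum, Finsupp.mul_sum]
  simp only [norm_mul, Real.mul_rpow (norm_nonneg _) (norm_nonneg _)]

theorem lpSum_mapDomain (p : ℝ) {φ : ℕ → ℕ} (hφ : φ.Injective) (a : ℕ →₀ 𝕜) :
    lpSum p (Finsupp.mapDomain φ a) = lpSum p a :=
  Finsupp.sum_mapDomain_index_inj hφ

theorem IsBlockSequence.lpSum_linearCombination {N : ℕ → ℕ} {β : ℕ → ℕ →₀ 𝕜} {p : ℝ} (hp : 0 < p)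
    (h : IsBlockSequence N β) (a : ℕ →₀ 𝕜) :
    lpSum p (Finsupp.linearCombination 𝕜 β a) = a.sum fun n c => ‖c‖ ^ p * lpSum p (β n) := by
  induction a using Finsupp.induction with
  | zero => simp [lpSum]
  | single_add n c a hn hc ih =>
    rw [map_add, Finsupp.linearCombination_single, Finsupp.sum_add_index_of_disjoint, ← ih,
      Finsupp.sum_single_index, ← lpSum_smul hp, lpSum, Finsupp.sum_add_index_of_disjoint]
    · rfl
    · rw [Finset.disjoint_left]
      intro k hk hk'
      obtain ⟨m, hm, h1⟩ := h.exists_mem_of_ne_zero a (Finsupp.mem_support_iff.1 hk')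
      have h2 : β n k ≠ 0 := fun h0 => by
        rw [Finsupp.mem_support_iff] at hk
        simp [h0] at hk
      have := h.1.eq_of_mem_Ico h1 (h.2 n k h2)
      exact hn (this ▸ hm)
    · simp [Real.zero_rpow hp.ne']
    · rw [Finset.disjoint_left]
      intro k hk hk'
      have := Finsupp.support_single_subset hk
      rw [Finset.mem_singleton] at this
      exact hn (this ▸ hk')

end Blocks

/-! ### Gliding hump -/

section GlidingHump

variable {𝕜 : Type*} [RCLike 𝕜]
variable {X : Type*} [NormedAddCommGroup X] [NormedSpace 𝕜 X]

/-- A sequence whose coordinates tend to zero has a subsequence close to a block sequence. -/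
theorem SchauderBasis.exists_blocks_near (b : SchauderBasis 𝕜 X) {d : ℕ → X}
    (hd : ∀ k, Filter.Tendsto (fun n => b.coord k (d n)) Filter.atTop (nhds 0))
    {ε : ℕ → ℝ} (hε : ∀ n, 0 < ε n) :
    ∃ (ψ N : ℕ → ℕ) (β : ℕ → ℕ →₀ 𝕜), StrictMono ψ ∧ IsBlockSequence N β ∧
      ∀ n, ‖d (ψ n) - Finsupp.linearCombination 𝕜 b.basis (β n)‖ ≤ ε n := by
  -- The state is a pair (index in `d`, right end of the last block). The index is chosen first, to
  -- make the head small; the new end is chosen afterwards, to make the tail small.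
  have step : ∀ (n : ℕ) (s : ℕ × ℕ), ∃ t : ℕ × ℕ, s.1 < t.1 ∧ s.2 < t.2 ∧
      ‖b.proj s.2 (d t.1)‖ ≤ ε n / 2 ∧ ‖d t.1 - b.proj t.2 (d t.1)‖ ≤ ε n / 2 := by
    rintro n ⟨m, N⟩
    have h1 : Filter.Tendsto (fun i => b.proj N (d i)) Filter.atTop (nhds 0) := by
      simp only [SchauderBasis.proj_apply]
      rw [← Finset.sum_const_zero (s := Finset.range N)]
      refine tendsto_finsetSum _ fun k _ => ?_
      simpa using (hd k).smul_const (b.basis k)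
    obtain ⟨m', hm', hm''⟩ := ((Metric.tendsto_nhds.1 h1 _ (half_pos (hε n))).and
      (Filter.eventually_gt_atTop m)).exists
    obtain ⟨N', hN', hN''⟩ := ((Metric.tendsto_nhds.1 (b.tendsto_proj (d m')) _
      (half_pos (hε n))).and (Filter.eventually_gt_atTop N)).exists
    refine ⟨(m', N'), hm'', hN'', ?_, ?_⟩
    · simpa using hm'.le
    · rw [← dist_eq_norm, dist_comm]; exact hN'.le
  choose next hnext using step
  let st : ℕ → ℕ × ℕ := fun n => Nat.rec (0, 0) next n
  have hst : ∀ n, st (n + 1) = next n (st n) := fun n => rfl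
  let ψ : ℕ → ℕ := fun n => (st (n + 1)).1
  let N : ℕ → ℕ := fun n => (st n).2
  have hN : StrictMono N := strictMono_nat_of_lt_succ fun n => (hnext n (st n)).2.1
  let β : ℕ → ℕ →₀ 𝕜 := fun n =>
    ∑ k ∈ Finset.Ico (N n) (N (n + 1)), Finsupp.single k (b.coord k (d (ψ n)))
  refine ⟨ψ, N, β, strictMono_nat_of_lt_succ fun n => (hnext (n + 1) (st (n + 1))).1,
    ⟨hN, fun n k hk => ?_⟩, fun n => ?_⟩
  · rw [Finsupp.finsetSum_apply] at hk
    obtain ⟨m, hm, h0⟩ := Finset.exists_ne_zero_of_sum_ne_zero hk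
    have : m = k := by
      by_contra hmk
      exact h0 (Finsupp.single_eq_of_ne' hmk)
    subst this
    exact Finset.mem_Ico.1 hm
  · have e : Finsupp.linearCombination 𝕜 b.basis (β n) =
        b.proj (N (n + 1)) (d (ψ n)) - b.proj (N n) (d (ψ n)) := by
      simp only [β, map_sum, Finsupp.linearCombination_single, SchauderBasis.proj_apply]
      rw [Finset.sum_Ico_eq_sub _ (hN.monotone n.le_succ)]
    rw [e, sub_sub_eq_add_sub, add_sub_right_comm]
    obtain ⟨-, -, h3, h4⟩ := hnext n (st n)
    refine (norm_add_le _ _).trans ?_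
    have := add_le_add h4 h3
    rw [add_halves] at this
    exact this

/-- Diagonal extraction for countably many bounded scalar sequences. -/
theorem exists_subseq_forall_tendsto {c : ℕ → ℕ → 𝕜} {R : ℕ → ℝ} (hc : ∀ k n, ‖c k n‖ ≤ R k) :
    ∃ φ : ℕ → ℕ, StrictMono φ ∧
      ∀ k, ∃ l, Filter.Tendsto (fun n => c k (φ n)) Filter.atTop (nhds l) := by
  -- The diagonal argument is sequential compactness of a countable product of closed balls.
  have hcomp : IsCompact (Set.univ.pi fun k => Metric.closedBall (0 : 𝕜) (R k)) :=
    isCompact_univ_pi fun k => isCompact_closedBall _ _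
  obtain ⟨l, -, φ, hφ, h⟩ := hcomp.tendsto_subseq (x := fun n k => c k n)
    fun n k _ => by simpa using hc k n
  exact ⟨φ, hφ, fun k => ⟨l k, (tendsto_pi_nhds.1 h) k⟩⟩

/-- A sequence equivalent to its subsequences is equivalent to a block sequence of a given
Schauder basis. -/
theorem SchauderBasis.exists_equivalent_blocks (b : SchauderBasis 𝕜 X) {z : ℕ → X} {K : ℝ}
    (hK : 0 < K) (hu : UnconditionalWith 𝕜 K z) (hz : Seminormalized z)
    (hs : ∀ φ : ℕ → ℕ, StrictMono φ → AreEquivalent 𝕜 z (z ∘ φ)) :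
    ∃ (N : ℕ → ℕ) (β : ℕ → ℕ →₀ 𝕜), IsBlockSequence N β ∧
      AreEquivalent 𝕜 z (fun n => Finsupp.linearCombination 𝕜 b.basis (β n)) := by
  obtain ⟨δ, M, hδ, hM, hz⟩ := hz
  obtain ⟨φ, hφ, hl⟩ := exists_subseq_forall_tendsto (c := fun k n => b.coord k (z n))
    (R := fun k => ‖b.coord k‖ * M)
    fun k n => (b.coord k).le_opNorm_of_le (hz n).2
  set d : ℕ → X := fun n => z (φ (2 * n)) - z (φ (2 * n + 1)) with hd
  have hzd : AreEquivalent 𝕜 z d := areEquivalent_differences hK hu hs hφ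
  have hcoord : ∀ k, Filter.Tendsto (fun n => b.coord k (d n)) Filter.atTop (nhds 0) := by
    intro k
    obtain ⟨l, hl⟩ := hl k
    have t0 : Filter.Tendsto (fun n : ℕ => 2 * n) Filter.atTop Filter.atTop :=
      Filter.tendsto_atTop_mono (fun n => by simp only [id]; omega) Filter.tendsto_id
    have t1 : Filter.Tendsto (fun n : ℕ => 2 * n + 1) Filter.atTop Filter.atTop :=
      Filter.tendsto_atTop_mono (fun n => by simp only [id]; omega) Filter.tendsto_id
    have := (hl.comp t0).sub (hl.comp t1)
    simpa [hd, Function.comp_def] using this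
  obtain ⟨C, hC, -, hzd2⟩ := id hzd.symm
  set L : ℝ := K * C / δ with hLdef
  have hLpos : 0 < L := by positivity
  have hL : ∀ (a : ℕ →₀ 𝕜) n, ‖a n‖ ≤ L * ‖Finsupp.linearCombination 𝕜 d a‖ := by
    intro a n
    rw [hLdef, div_mul_eq_mul_div, le_div_iff₀ hδ]
    calc ‖a n‖ * δ ≤ ‖a n‖ * ‖z n‖ := mul_le_mul_of_nonneg_left (hz n).1 (norm_nonneg _)
      _ ≤ K * ‖Finsupp.linearCombination 𝕜 z a‖ := hu.norm_coeff_mul_le a n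
      _ ≤ K * (C * ‖Finsupp.linearCombination 𝕜 d a‖) :=
          mul_le_mul_of_nonneg_left (hzd2 a) hK.le
      _ = _ := by ring
  -- The total is `1 / (2 * L)`, the largest perturbation that `areEquivalent_of_perturbation`
  -- tolerates.
  set ε : ℕ → ℝ := fun n => (1 / 2) ^ n * (1 / (4 * L)) with hεdef
  have hε : ∀ n, 0 < ε n := fun n => by positivity
  obtain ⟨ψ, N, β, hψ, hβ, hnear⟩ := b.exists_blocks_near hcoord hε
  refine ⟨N, β, hβ, ((hs ψ hψ).trans (hzd.comp ψ)).trans ?_⟩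
  refine areEquivalent_of_perturbation (L := L) (ε := ε) (fun a n => ?_) hnear fun A => ?_
  · have h := hL (Finsupp.mapDomain ψ a) (ψ n)
    rwa [Finsupp.mapDomain_apply hψ.injective, ← linearCombination_comp] at h
  · have h1 : ∑ n ∈ A, ε n ≤ 2 * (1 / (4 * L)) := by
      rw [← Finset.sum_mul]
      refine mul_le_mul_of_nonneg_right ?_ (by positivity)
      exact (summable_geometric_two.sum_le_tsum A fun _ _ => by positivity).trans_eq
        tsum_geometric_two
    calc L * ∑ n ∈ A, ε n ≤ L * (2 * (1 / (4 * L))) := mul_le_mul_of_nonneg_left h1 hLpos.le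
      _ = 1 / 2 := by field_simp; norm_num

end GlidingHump

/-! ### Sequences equivalent to the unit vectors of `ℓ_p` -/

section LpLike

variable {𝕜 : Type*} [RCLike 𝕜]
variable {X : Type*} [NormedAddCommGroup X] [NormedSpace 𝕜 X]
variable {Y : Type*} [NormedAddCommGroup Y] [NormedSpace 𝕜 Y]

variable (𝕜) in
/-- The sequence is equivalent to the unit vectors of `ℓ_p`. -/
def IsLpSequence (p : ℝ) (x : ℕ → X) : Prop :=
  ∃ C : ℝ, 0 < C ∧ ∀ a : ℕ →₀ 𝕜, lpSum p a ≤ C * ‖Finsupp.linearCombination 𝕜 x a‖ ^ p ∧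
    ‖Finsupp.linearCombination 𝕜 x a‖ ^ p ≤ C * lpSum p a

theorem IsLpSequence.of_areEquivalent {p : ℝ} (hp : 0 < p) {x : ℕ → X} {y : ℕ → Y}
    (hx : IsLpSequence 𝕜 p x) (h : AreEquivalent 𝕜 x y) : IsLpSequence 𝕜 p y := by
  obtain ⟨C, hC, hx⟩ := hx
  obtain ⟨D, hD, h1, h2⟩ := h
  have hDp : 0 < D ^ p := Real.rpow_pos_of_pos hD p
  have pow_le : ∀ {s t : ℝ}, 0 ≤ s → 0 ≤ t → s ≤ D * t → s ^ p ≤ D ^ p * t ^ p := by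
    intro s t hs ht hst
    rw [← Real.mul_rpow hD.le ht]
    exact Real.rpow_le_rpow hs hst hp.le
  refine ⟨C * D ^ p, by positivity, fun a => ⟨(hx a).1.trans ?_, ?_⟩⟩
  · rw [mul_assoc]
    exact mul_le_mul_of_nonneg_left (pow_le (norm_nonneg _) (norm_nonneg _) (h1 a)) hC.le
  · refine (pow_le (norm_nonneg _) (norm_nonneg _) (h2 a)).trans ?_
    rw [mul_comm C, mul_assoc]
    exact mul_le_mul_of_nonneg_left (hx a).2 hDp.le

theorem IsLpSequence.dominates {p : ℝ} (hp : 0 < p) {x : ℕ → X} {y : ℕ → Y}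
    (hx : IsLpSequence 𝕜 p x) (hy : IsLpSequence 𝕜 p y) : Dominates 𝕜 x y := by
  obtain ⟨C, hC, hx⟩ := hx
  obtain ⟨D, hD, hy⟩ := hy
  refine ⟨(D * C) ^ (1 / p), by positivity, fun a => ?_⟩
  rw [← Real.rpow_le_rpow_iff (norm_nonneg _) (by positivity) hp,
    Real.mul_rpow (by positivity) (norm_nonneg _), ← Real.rpow_mul (by positivity),
    one_div_mul_cancel hp.ne', Real.rpow_one]
  refine (hy a).2.trans ?_
  rw [mul_assoc]
  exact mul_le_mul_of_nonneg_left (hx a).1 hD.le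

/-- A seminormalized block sequence of a sequence equivalent to the `ℓ_p` basis is equivalent to the
`ℓ_p` basis. -/
theorem IsLpSequence.blocks {p : ℝ} (hp : 0 < p) {x : ℕ → X} (hx : IsLpSequence 𝕜 p x)
    {N : ℕ → ℕ} {β : ℕ → ℕ →₀ 𝕜} (hβ : IsBlockSequence N β)
    (hsn : Seminormalized fun n => Finsupp.linearCombination 𝕜 x (β n)) :
    IsLpSequence 𝕜 p fun n => Finsupp.linearCombination 𝕜 x (β n) := by
  obtain ⟨C, hC, hx⟩ := hx
  obtain ⟨δ, M, hδ, hM, hsn⟩ := hsn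
  have hδp : 0 < δ ^ p := Real.rpow_pos_of_pos hδ p
  have hMp : 0 < M ^ p := Real.rpow_pos_of_pos hM p
  have low : ∀ n, 1 ≤ C / δ ^ p * lpSum p (β n) := fun n => by
    rw [div_mul_eq_mul_div, le_div_iff₀ hδp, one_mul]
    exact (Real.rpow_le_rpow hδ.le (hsn n).1 hp.le).trans (hx _).2
  have up : ∀ n, lpSum p (β n) ≤ C * M ^ p := fun n =>
    (hx _).1.trans (mul_le_mul_of_nonneg_left
      (Real.rpow_le_rpow (norm_nonneg _) (hsn n).2 hp.le) hC.le)
  have low' : ∀ a : ℕ →₀ 𝕜, lpSum p a ≤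
      C / δ ^ p * lpSum p (Finsupp.linearCombination 𝕜 β a) := fun a => by
    rw [hβ.lpSum_linearCombination hp, lpSum, Finsupp.sum, Finsupp.sum, Finset.mul_sum]
    refine Finset.sum_le_sum fun n _ => ?_
    have h0 : 0 ≤ ‖a n‖ ^ p := by positivity
    have := mul_le_mul_of_nonneg_left (low n) h0
    linarith
  have up' : ∀ a : ℕ →₀ 𝕜, lpSum p (Finsupp.linearCombination 𝕜 β a) ≤
      C * M ^ p * lpSum p a := fun a => by
    rw [hβ.lpSum_linearCombination hp, lpSum, Finsupp.sum, Finsupp.sum, Finset.mul_sum]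
    refine Finset.sum_le_sum fun n _ => ?_
    have h0 : 0 ≤ ‖a n‖ ^ p := by positivity
    have := mul_le_mul_of_nonneg_left (up n) h0
    linarith
  refine ⟨max (C / δ ^ p * C) (C * (C * M ^ p)), by positivity, fun a => ?_⟩
  rw [linearCombination_blocks]
  have hn : 0 ≤ ‖Finsupp.linearCombination 𝕜 x (Finsupp.linearCombination 𝕜 β a)‖ ^ p := by
    positivity
  constructor
  · calc lpSum p a ≤ C / δ ^ p * lpSum p (Finsupp.linearCombination 𝕜 β a) := low' a
      _ ≤ C / δ ^ p * (C * _) := mul_le_mul_of_nonneg_left (hx _).1 (by positivity)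
      _ = C / δ ^ p * C * _ := by rw [mul_assoc]
      _ ≤ _ := mul_le_mul_of_nonneg_right (le_max_left _ _) hn
  · calc _ ≤ C * lpSum p (Finsupp.linearCombination 𝕜 β a) := (hx _).2
      _ ≤ C * (C * M ^ p * lpSum p a) := mul_le_mul_of_nonneg_left (up' a) hC.le
      _ = C * (C * M ^ p) * lpSum p a := by ring
      _ ≤ _ := mul_le_mul_of_nonneg_right (le_max_right _ _) (lpSum_nonneg p a)

end LpLike

/-! ### Unconditional basic sequences -/

/-- Any increasing exhaustion of `ℕ` by finite sets consists of initial segments of some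
enumeration. -/
theorem exists_perm_image_range {B : ℕ → Finset ℕ} (hB : Monotone B) (hex : ∀ i, ∃ k, i ∈ B k) :
    ∃ σ : Equiv.Perm ℕ, ∀ k, ∃ m, (Finset.range m).image σ = B k := by
  classical
  -- Order the integers by the stage at which they enter, then by size. Each `B k` is an initial
  -- segment of this order, and the enumeration sought is the inverse of the rank function.
  let key : ℕ → ℕ := fun i => Nat.find (hex i)
  have hkey : ∀ i, i ∈ B (key i) := fun i => Nat.find_spec (hex i)
  have hkey_le : ∀ {i k}, i ∈ B k ↔ key i ≤ k := fun {i k} =>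
    ⟨fun h => Nat.find_min' _ h, fun h => hB h (hkey i)⟩
  let lt : ℕ → ℕ → Prop := fun i j => key i < key j ∨ key i = key j ∧ i < j
  let before : ℕ → Finset ℕ := fun j => (B (key j)).filter fun i => lt i j
  have mem_before : ∀ {i j}, i ∈ before j ↔ lt i j := fun {i j} => by
    simp only [before, Finset.mem_filter, and_iff_right_iff_imp, lt]
    intro h
    exact hkey_le.2 (by omega)
  let rank : ℕ → ℕ := fun j => (before j).card
  have rank_lt : ∀ {i j}, lt i j → rank i < rank j := fun {i j} h => by
    refine Finset.card_lt_card ((Finset.ssubset_iff_of_subset fun k hk => ?_).2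
      ⟨i, mem_before.2 h, fun hi => ?_⟩)
    · rw [mem_before] at hk ⊢
      simp only [lt] at hk h ⊢
      omega
    · rw [mem_before] at hi
      simp only [lt] at hi
      omega
  have rank_inj : Function.Injective rank := fun i j hij => by
    by_contra hne
    have : lt i j ∨ lt j i := by simp only [lt]; omega
    rcases this with h | h
    · exact (rank_lt h).ne hij
    · exact (rank_lt h).ne' hij
  have himg : ∀ k, (B k).image rank = Finset.range (B k).card := fun k => by
    refine Finset.eq_of_subset_of_card_le (fun r hr => ?_) ?_
    · obtain ⟨j, hj, rfl⟩ := Finset.mem_image.1 hr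
      rw [Finset.mem_range]
      refine Finset.card_lt_card ((Finset.ssubset_iff_of_subset fun i hi => ?_).2
        ⟨j, hj, fun h => ?_⟩)
      · rw [mem_before] at hi
        rw [hkey_le] at hj ⊢
        simp only [lt] at hi
        omega
      · rw [mem_before] at h
        simp only [lt] at h
        omega
    · rw [Finset.card_range, Finset.card_image_of_injective _ rank_inj]
  have rank_surj : Function.Surjective rank := fun r => by
    obtain ⟨k, hk⟩ : ∃ k, Finset.range (r + 1) ⊆ B k := by
      refine ⟨(Finset.range (r + 1)).sup key, fun i hi => hkey_le.2 (Finset.le_sup hi)⟩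
    have h1 : r ∈ Finset.range (B k).card := by
      have := Finset.card_le_card hk
      rw [Finset.card_range] at this
      exact Finset.mem_range.2 (by omega)
    rw [← himg k] at h1
    obtain ⟨j, -, hj⟩ := Finset.mem_image.1 h1
    exact ⟨j, hj⟩
  let e : Equiv.Perm ℕ := Equiv.ofBijective rank ⟨rank_inj, rank_surj⟩
  refine ⟨e.symm, fun k => ⟨(B k).card, ?_⟩⟩
  rw [← himg k, Finset.image_image]
  have : (e.symm ∘ rank : ℕ → ℕ) = id := funext fun i => e.symm_apply_apply i
  rw [this, Finset.image_id]

section Unconditional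

variable {𝕜 : Type*} [RCLike 𝕜]
variable {X : Type*} [NormedAddCommGroup X] [NormedSpace 𝕜 X]

theorem SchauderBasis.coord_linearCombination (b : SchauderBasis 𝕜 X) (a : ℕ →₀ 𝕜) (k : ℕ) :
    b.coord k (Finsupp.linearCombination 𝕜 b.basis a) = a k := by
  rw [Finsupp.linearCombination_apply, Finsupp.sum, map_sum, Finset.sum_eq_single k]
  · simp [b.ortho]
  · intro m _ hm
    simp [b.ortho, hm.symm]
  · intro h
    simp [Finsupp.notMem_support_iff.1 h]

/-- Truncation of the coefficients is the action of `b.proj N`, and these projections are uniformly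
bounded on a complete space. -/
theorem SchauderBasis.exists_norm_filter_lt_le [CompleteSpace X] (b : SchauderBasis 𝕜 X) :
    ∃ C : ℝ, 0 < C ∧ ∀ (N : ℕ) (a : ℕ →₀ 𝕜),
      ‖Finsupp.linearCombination 𝕜 b.basis (a.filter (· ∈ Finset.range N))‖ ≤
        C * ‖Finsupp.linearCombination 𝕜 b.basis a‖ := by
  obtain ⟨C, hC⟩ := b.exists_norm_proj_le
  refine ⟨max C 1, by positivity, fun N a => ?_⟩
  have : Finsupp.linearCombination 𝕜 b.basis (a.filter (· ∈ Finset.range N)) =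
      b.proj N (Finsupp.linearCombination 𝕜 b.basis a) := by
    rw [b.proj_apply]
    simp only [b.coord_linearCombination]
    rw [Finsupp.linearCombination_apply, Finsupp.sum_of_support_subset (s := Finset.range N)]
    · exact Finset.sum_congr rfl fun k hk => by rw [Finsupp.filter_apply_pos _ _ hk]
    · intro k hk
      rw [Finsupp.support_filter] at hk
      exact (Finset.mem_filter.1 hk).2
    · simp
  rw [this]
  exact (b.proj N).le_of_opNorm_le ((hC N).trans (le_max_left _ _)) _

theorem norm_linearCombination_closedSpan (x : ℕ → X) (a : ℕ →₀ 𝕜) :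
    ‖Finsupp.linearCombination 𝕜
      (fun n => (⟨x n, mem_closedSpan 𝕜 x n⟩ : closedSpan 𝕜 x)) a‖ =
    ‖Finsupp.linearCombination 𝕜 x a‖ := by
  have := Finsupp.apply_linearCombination 𝕜 (closedSpan 𝕜 x).subtype
    (fun n => (⟨x n, mem_closedSpan 𝕜 x n⟩ : closedSpan 𝕜 x)) a
  exact congrArg norm this

instance closedSpan.completeSpace [CompleteSpace X] (x : ℕ → X) :
    CompleteSpace (closedSpan 𝕜 x) :=
  (Submodule.isClosed_topologicalClosure _).completeSpace_coe

theorem IsBasicSequence.exists_norm_filter_lt_le [CompleteSpace X] {x : ℕ → X}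
    (h : IsBasicSequence 𝕜 x) :
    ∃ C : ℝ, 0 < C ∧ ∀ (N : ℕ) (a : ℕ →₀ 𝕜),
      ‖Finsupp.linearCombination 𝕜 x (a.filter (· ∈ Finset.range N))‖ ≤
        C * ‖Finsupp.linearCombination 𝕜 x a‖ := by
  obtain ⟨b, hb⟩ := h
  obtain ⟨C, hC, h⟩ := b.exists_norm_filter_lt_le
  refine ⟨C, hC, fun N a => ?_⟩
  have := h N a
  rwa [hb, norm_linearCombination_closedSpan, norm_linearCombination_closedSpan] at this

theorem IsBasicSequence.ne_zero {x : ℕ → X} (h : IsBasicSequence 𝕜 x) (n : ℕ) : x n ≠ 0 := by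
  obtain ⟨b, hb⟩ := h
  intro h0
  have h1 := b.ortho n n
  have h2 : b.basis n = 0 := by rw [hb]; exact Subtype.ext h0
  simp [h2] at h1

/-- This is the truncation bound for the basic sequence `x ∘ σ`, with coefficients relabelled. The
constant still depends on `σ`. -/
theorem IsUnconditionalBasic.exists_norm_filter_image_le [CompleteSpace X] {x : ℕ → X}
    (h : IsUnconditionalBasic 𝕜 x) (σ : Equiv.Perm ℕ) :
    ∃ C : ℝ, 0 < C ∧ ∀ (N : ℕ) (a : ℕ →₀ 𝕜),
      ‖Finsupp.linearCombination 𝕜 x (a.filter (· ∈ (Finset.range N).image σ))‖ ≤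
        C * ‖Finsupp.linearCombination 𝕜 x a‖ := by
  obtain ⟨C, hC, h⟩ := (h.2 σ).exists_norm_filter_lt_le
  refine ⟨C, hC, fun N a => ?_⟩
  have h1 := h N (Finsupp.equivMapDomain σ.symm a)
  rw [linearCombination_comp, linearCombination_comp] at h1
  have e1 : Finsupp.mapDomain σ (Finsupp.equivMapDomain σ.symm a) = a := by
    rw [← Finsupp.equivMapDomain_eq_mapDomain, ← Finsupp.equivMapDomain_trans]
    simp [Finsupp.equivMapDomain_refl]
  have e2 : Finsupp.mapDomain σ
      ((Finsupp.equivMapDomain σ.symm a).filter (· ∈ Finset.range N)) =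
      a.filter (· ∈ (Finset.range N).image σ) := by
    rw [← Finsupp.equivMapDomain_eq_mapDomain]
    ext k
    rw [Finsupp.equivMapDomain_apply, Finsupp.filter_apply, Finsupp.filter_apply,
      Finsupp.equivMapDomain_apply]
    have : k ∈ (Finset.range N).image σ ↔ σ.symm k ∈ Finset.range N := by
      rw [Finset.mem_image]
      constructor
      · rintro ⟨i, hi, rfl⟩
        simpa using hi
      · intro h
        exact ⟨_, h, σ.apply_symm_apply k⟩
    simp only [this, Equiv.symm_symm, Equiv.apply_symm_apply]
  rwa [e1, e2] at h1

/-- If no constant served all finite sets, worse and worse sets could be found in successive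
intervals. A single permutation having all of them as differences of initial segments would then
violate its own truncation bound. -/
theorem IsUnconditionalBasic.exists_norm_filter_le [CompleteSpace X] {x : ℕ → X}
    (h : IsUnconditionalBasic 𝕜 x) :
    ∃ C : ℝ, 0 < C ∧ ∀ (A : Finset ℕ) (a : ℕ →₀ 𝕜),
      ‖Finsupp.linearCombination 𝕜 x (a.filter (· ∈ A))‖ ≤
        C * ‖Finsupp.linearCombination 𝕜 x a‖ := by
  classical
  by_contra! hcon
  obtain ⟨C, hC, hlt⟩ := h.1.exists_norm_filter_lt_le
  -- Selections below a fixed `N` are harmless, each single index being a difference of two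
  -- truncations; so the bad sets may be pushed beyond any given point.
  have hsmall : ∀ N : ℕ, ∃ D : ℝ, 0 < D ∧ ∀ (A : Finset ℕ) (a : ℕ →₀ 𝕜),
      ‖Finsupp.linearCombination 𝕜 x (a.filter fun i => i ∈ A ∧ i < N)‖ ≤
        D * ‖Finsupp.linearCombination 𝕜 x a‖ := by
    intro N
    induction N with
    | zero => 
      refine ⟨1, one_pos, fun A a => ?_⟩
      have e : a.filter (fun i => i ∈ A ∧ i < 0) = 0 := by ext i; simp
      rw [e, map_zero, norm_zero, one_mul]
      exact norm_nonneg _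
    | succ N ih =>
      obtain ⟨D, hD, ih⟩ := ih
      refine ⟨D + (C + C), by positivity, fun A a => ?_⟩
      have h1 := ih A a
      have h2 := hlt N a
      have h3 := hlt (N + 1) a
      have h4 := norm_nonneg (Finsupp.linearCombination 𝕜 x a)
      by_cases hN : N ∈ A
      · have e : a.filter (fun i => i ∈ A ∧ i < N + 1) = a.filter (fun i => i ∈ A ∧ i < N) +
            (a.filter (· ∈ Finset.range (N + 1)) - a.filter (· ∈ Finset.range N)) := by
          ext i
          simp only [Finsupp.filter_apply, Finsupp.add_apply, Finsupp.sub_apply, Finset.mem_range]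
          rcases lt_trichotomy i N with hi | rfl | hi
          · simp [hi, Nat.lt_succ_of_lt hi]
          · simp [hN]
          · simp [not_lt.2 hi.le, not_lt.2 (Nat.succ_le_of_lt hi)]
        rw [e, map_add, map_sub, add_mul, add_mul]
        exact (norm_add_le _ _).trans (add_le_add h1 ((norm_sub_le _ _).trans (add_le_add h3 h2)))
      · have e : a.filter (fun i => i ∈ A ∧ i < N + 1) = a.filter (fun i => i ∈ A ∧ i < N) := by
          ext i
          simp only [Finsupp.filter_apply]
          have : (i ∈ A ∧ i < N + 1) ↔ (i ∈ A ∧ i < N) :=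
            and_congr_right fun hi => by
              have : i ≠ N := fun h => hN (h ▸ hi)
              omega
          simp only [this]
        rw [e]
        nlinarith
  have step : ∀ k n : ℕ, ∃ A : Finset ℕ, (∀ i ∈ A, n ≤ i) ∧ ∃ a : ℕ →₀ 𝕜,
      k * ‖Finsupp.linearCombination 𝕜 x a‖ <
        ‖Finsupp.linearCombination 𝕜 x (a.filter (· ∈ A))‖ := by
    intro k n
    obtain ⟨D, hD, hDle⟩ := hsmall n
    obtain ⟨A, a, hA⟩ := hcon (k + D) (by positivity)
    refine ⟨A.filter (n ≤ ·), fun i hi => (Finset.mem_filter.1 hi).2, a, ?_⟩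
    have e : a.filter (· ∈ A) = a.filter (fun i => i ∈ A ∧ i < n) +
        a.filter (· ∈ A.filter (n ≤ ·)) := by
      ext i
      simp only [Finsupp.filter_apply, Finsupp.add_apply, Finset.mem_filter]
      by_cases hi : i ∈ A <;> by_cases hin : i < n <;> simp [hi, hin, not_le.2, not_lt.1]
    rw [e, map_add, add_mul] at hA
    have h1 := norm_add_le (Finsupp.linearCombination 𝕜 x (a.filter (fun i => i ∈ A ∧ i < n)))
      (Finsupp.linearCombination 𝕜 x (a.filter (· ∈ A.filter (n ≤ ·))))
    have h2 := hDle A a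
    linarith
  choose A hA a ha using step
  let n : ℕ → ℕ := fun k => Nat.rec 0 (fun k m => max m ((A k m).sup id) + 1) k
  have hn : ∀ k, n (k + 1) = max (n k) ((A k (n k)).sup id) + 1 := fun k => rfl
  have hnlt : ∀ k, n k < n (k + 1) := fun k => by rw [hn]; omega
  have hnm : StrictMono n := strictMono_nat_of_lt_succ hnlt
  -- The `k`-th bad set lies in `[n k, n (k + 1))`, so these sets increase, and selecting it is
  -- selecting `B k` minus selecting `range (n k)`. The cost is at most `D + C`, contradicting the
  -- factor `k`.
  let B : ℕ → Finset ℕ := fun k => Finset.range (n k) ∪ A k (n k)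
  have hB : Monotone B := by
    refine monotone_nat_of_le_succ fun k => ?_
    refine Finset.union_subset ?_ ?_ |>.trans Finset.subset_union_left
    · exact Finset.range_subset_range.2 (hnlt k).le
    · intro i hi
      have : i ≤ (A k (n k)).sup id := Finset.le_sup (f := id) hi
      rw [Finset.mem_range, hn]
      omega
  obtain ⟨σ, hσ⟩ := exists_perm_image_range hB fun i => ⟨i + 1, by
    have := hnm.le_apply (x := i + 1)
    simp only [B, Finset.mem_union, Finset.mem_range]
    left; omega⟩
  obtain ⟨D, hD, hDle⟩ := h.exists_norm_filter_image_le σ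
  obtain ⟨k, hk⟩ := exists_nat_gt (D + C)
  obtain ⟨m, hm⟩ := hσ k
  have h1 := hDle m (a k (n k))
  rw [hm] at h1
  have e : (a k (n k)).filter (· ∈ A k (n k)) = (a k (n k)).filter (· ∈ B k) -
      (a k (n k)).filter (· ∈ Finset.range (n k)) := by
    ext i
    simp only [Finsupp.filter_apply, Finsupp.sub_apply, Finset.mem_range]
    by_cases hi : i ∈ A k (n k)
    · have h0 := hA k (n k) i hi
      have : i ∈ B k := Finset.mem_union_right _ hi
      simp [hi, not_lt.2 h0, this]
    · have : i ∈ B k ↔ i ∈ Finset.range (n k) := by simp [B, hi]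
      rw [if_neg hi]
      by_cases hb : i ∈ B k
      · rw [if_pos hb, if_pos (this.1 hb), sub_self]
      · rw [if_neg hb, if_neg fun h => hb (this.2 h), sub_self]
  have h2 := ha k (n k)
  have h3 := hlt (n k) (a k (n k))
  rw [e, map_sub] at h2
  have h4 := norm_sub_le
    (Finsupp.linearCombination 𝕜 x ((a k (n k)).filter (· ∈ B k)))
    (Finsupp.linearCombination 𝕜 x ((a k (n k)).filter (· ∈ Finset.range (n k))))
  have h5 := norm_nonneg (Finsupp.linearCombination 𝕜 x (a k (n k)))
  nlinarith

/-- A uniform bound on subsums of a finite family of scalars bounds the sum of the norms. -/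
theorem sum_norm_le_of_norm_subsum_le {s : Finset ℕ} {f : ℕ → 𝕜} {R : ℝ}
    (h : ∀ t ⊆ s, ‖∑ i ∈ t, f i‖ ≤ R) : ∑ i ∈ s, ‖f i‖ ≤ 4 * R := by
  classical
  -- The constant 4 is two signs for each of the real and imaginary parts.
  have key : ∀ g : 𝕜 →ₗ[ℝ] ℝ, (∀ z, |g z| ≤ ‖z‖) → ∑ i ∈ s, |g (f i)| ≤ 2 * R := by
    intro g hg
    have h1 : ∑ i ∈ s with 0 ≤ g (f i), |g (f i)| ≤ R := by
      calc ∑ i ∈ s with 0 ≤ g (f i), |g (f i)| = ∑ i ∈ s with 0 ≤ g (f i), g (f i) :=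
            Finset.sum_congr rfl fun i hi => abs_of_nonneg (Finset.mem_filter.1 hi).2
        _ = g (∑ i ∈ s with 0 ≤ g (f i), f i) := (map_sum _ _ _).symm
        _ ≤ _ := (le_abs_self _).trans ((hg _).trans (h _ (Finset.filter_subset _ _)))
    have h2 : ∑ i ∈ s with ¬ 0 ≤ g (f i), |g (f i)| ≤ R := by
      calc ∑ i ∈ s with ¬ 0 ≤ g (f i), |g (f i)| = ∑ i ∈ s with ¬ 0 ≤ g (f i), -g (f i) :=
            Finset.sum_congr rfl fun i hi =>
              abs_of_neg (not_le.1 (Finset.mem_filter.1 hi).2)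
        _ = -g (∑ i ∈ s with ¬ 0 ≤ g (f i), f i) := by rw [map_sum, Finset.sum_neg_distrib]
        _ ≤ _ := (neg_le_abs _).trans ((hg _).trans (h _ (Finset.filter_subset _ _)))
    rw [← Finset.sum_filter_add_sum_filter_not s fun i => 0 ≤ g (f i)]
    linarith
  have hre := key RCLike.reLm fun z => RCLike.abs_re_le_norm z
  have him := key RCLike.imLm fun z => RCLike.abs_im_le_norm z
  calc ∑ i ∈ s, ‖f i‖ ≤ ∑ i ∈ s, (|RCLike.reLm (f i)| + |RCLike.imLm (f i)|) :=
        Finset.sum_le_sum fun i _ => by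
          conv_lhs => rw [← RCLike.re_add_im (f i)]
          refine (norm_add_le _ _).trans ?_
          rw [norm_mul, RCLike.norm_ofReal, RCLike.norm_ofReal]
          refine add_le_add le_rfl (mul_le_of_le_one_right (abs_nonneg _) ?_)
          rw [RCLike.norm_I]
          split_ifs <;> norm_num
    _ ≤ 4 * R := by rw [Finset.sum_add_distrib]; linarith

/-- Test against a functional `g`: the subset bound controls all subsums of the scalars `g (b n • x
n)`, hence the sum of their absolute values, and this last quantity only decreases when coefficients
shrink. -/
theorem IsUnconditionalBasic.exists_unconditionalWith [CompleteSpace X] {x : ℕ → X}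
    (h : IsUnconditionalBasic 𝕜 x) : ∃ K : ℝ, 0 < K ∧ UnconditionalWith 𝕜 K x := by
  obtain ⟨C, hC, hle⟩ := h.exists_norm_filter_le
  refine ⟨4 * C, by positivity, fun a b hab => ?_⟩
  refine NormedSpace.norm_le_dual_bound 𝕜 _ (by positivity) fun g => ?_
  have hsub : a.support ⊆ b.support := fun n hn => by
    rw [Finsupp.mem_support_iff] at *
    intro h0
    have := hab n
    rw [h0, norm_zero] at this
    exact hn (norm_le_zero_iff.1 this)
  have h1 : ∑ n ∈ b.support, ‖g (b n • x n)‖ ≤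
      4 * (‖g‖ * (C * ‖Finsupp.linearCombination 𝕜 x b‖)) := by
    refine sum_norm_le_of_norm_subsum_le fun t ht => ?_
    have h2 := g.le_opNorm_of_le (hle t b)
    rw [Finsupp.linearCombination_apply, Finsupp.sum_of_support_subset (s := t)] at h2
    · rw [← map_sum]
      convert! h2 using 4 with i hi
      rw [Finsupp.filter_apply_pos _ _ hi]
    · intro k hk
      rw [Finsupp.support_filter] at hk
      exact (Finset.mem_filter.1 hk).2
    · simp
  rw [Finsupp.linearCombination_apply, Finsupp.sum_of_support_subset _ hsub _ (by simp), map_sum]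
  calc ‖∑ n ∈ b.support, g (a n • x n)‖ ≤ ∑ n ∈ b.support, ‖g (b n • x n)‖ := by
        refine (norm_sum_le _ _).trans (Finset.sum_le_sum fun n _ => ?_)
        rw [map_smul, map_smul, norm_smul, norm_smul]
        exact mul_le_mul_of_nonneg_right (hab n) (norm_nonneg _)
    _ ≤ _ := h1
    _ = _ := by ring

end Unconditional

/-! ### Finite sections of the Garling norm -/

section GarlingSum

variable {𝕜 : Type*} [RCLike 𝕜]

/-- The number of elements of `A` below `j`. -/
def rankIn (A : Finset ℕ) (j : ℕ) : ℕ := (A.filter (· < j)).card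

theorem rankIn_mono {A B : Finset ℕ} (h : A ⊆ B) (j : ℕ) : rankIn A j ≤ rankIn B j :=
  Finset.card_le_card (Finset.filter_subset_filter _ h)

theorem rankIn_lt_rankIn {A : Finset ℕ} {i j : ℕ} (hi : i ∈ A) (hij : i < j) :
    rankIn A i < rankIn A j := by
  refine Finset.card_lt_card ((Finset.ssubset_iff_of_subset fun k hk => ?_).2 ⟨i, ?_, ?_⟩)
  · rw [Finset.mem_filter] at hk ⊢
    exact ⟨hk.1, hk.2.trans hij⟩
  · exact Finset.mem_filter.2 ⟨hi, hij⟩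
  · simp

theorem rankIn_injOn (A : Finset ℕ) : Set.InjOn (rankIn A) A := fun i hi j hj h => by
  rcases lt_trichotomy i j with hij | hij | hij
  · exact absurd h (rankIn_lt_rankIn hi hij).ne
  · exact hij
  · exact absurd h (rankIn_lt_rankIn hj hij).ne'

theorem rankIn_range {m n : ℕ} (h : n < m) : rankIn (Finset.range m) n = n := by
  rw [rankIn]
  have : (Finset.range m).filter (· < n) = Finset.range n := by
    ext i
    simp only [Finset.mem_filter, Finset.mem_range]
    omega
  rw [this, Finset.card_range]

theorem rankIn_image {φ : ℕ → ℕ} (hφ : StrictMono φ) (A : Finset ℕ) (n : ℕ) :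
    rankIn (A.image φ) (φ n) = rankIn A n := by
  rw [rankIn, rankIn, Finset.filter_image, Finset.card_image_of_injective _ hφ.injective]
  simp only [hφ.lt_iff_lt]

/-- The weighted sum of the `p`-th powers of the entries with index in `A`, listed increasingly. -/
def garlingSum (w : GarlingWeight) (p : ℝ) (a : ℕ → 𝕜) (A : Finset ℕ) : ℝ :=
  ∑ j ∈ A, ‖a j‖ ^ p * w.val (rankIn A j)

variable (w : GarlingWeight) {p : ℝ}

theorem garlingSum_term_nonneg (p : ℝ) (a : ℕ → 𝕜) (j n : ℕ) : 0 ≤ ‖a j‖ ^ p * w.val n :=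
  mul_nonneg (Real.rpow_nonneg (norm_nonneg _) _) (w.pos _).le

theorem GarlingWeight.val_le_one (n : ℕ) : w.val n ≤ 1 := by
  simpa [w.val_zero] using w.antitone (Nat.zero_le n)

theorem garlingSum_congr {a b : ℕ → 𝕜} {A : Finset ℕ} (h : ∀ j ∈ A, ‖a j‖ = ‖b j‖) :
    garlingSum w p a A = garlingSum w p b A :=
  Finset.sum_congr rfl fun j hj => by rw [h j hj]

/-- Removing indices lowers the ranks of those that remain, and the weights are nonincreasing. -/
theorem sum_subset_le_garlingSum (a : ℕ → 𝕜) {A B : Finset ℕ} (h : B ⊆ A) :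
    ∑ j ∈ B, ‖a j‖ ^ p * w.val (rankIn A j) ≤ garlingSum w p a B :=
  Finset.sum_le_sum fun j _ => mul_le_mul_of_nonneg_left (w.antitone (rankIn_mono h j))
    (Real.rpow_nonneg (norm_nonneg _) _)

theorem garlingSum_le_of_subset (hp : 0 < p) {a : ℕ → 𝕜} {A B : Finset ℕ} (h : B ⊆ A)
    (h0 : ∀ j ∈ A, j ∉ B → a j = 0) : garlingSum w p a A ≤ garlingSum w p a B := by
  refine le_trans (le_of_eq ?_) (sum_subset_le_garlingSum w a h)
  refine (Finset.sum_subset h fun j hj hjB => ?_).symm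
  simp [h0 j hj hjB, Real.zero_rpow hp.ne']

theorem garlingSum_image {φ : ℕ → ℕ} (hφ : StrictMono φ) (a : ℕ → 𝕜) (A : Finset ℕ) :
    garlingSum w p a (A.image φ) = garlingSum w p (a ∘ φ) A := by
  rw [garlingSum, Finset.sum_image fun _ _ _ _ h => hφ.injective h]
  simp only [rankIn_image hφ]
  rfl

theorem garlingSum_range (a : ℕ → 𝕜) (m : ℕ) :
    garlingSum w p a (Finset.range m) = ∑ n ∈ Finset.range m, ‖a n‖ ^ p * w.val n :=
  Finset.sum_congr rfl fun n hn => by rw [rankIn_range (Finset.mem_range.1 hn)]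

/-- Appending to `A` all but the first `R` elements of `A'`, where `A` has at most `R` elements. -/
theorem exists_garlingSum_union_ge {a : ℕ → 𝕜} {A A' : Finset ℕ} {R : ℕ} {s : ℝ} (hs : 0 ≤ s)
    (hlt : ∀ i ∈ A, ∀ j ∈ A', i < j) (hcard : A.card ≤ R)
    (hsmall : ∀ j ∈ A', R * ‖a j‖ ^ p ≤ s) :
    ∃ B ⊆ A', garlingSum w p a A + garlingSum w p a A' - s ≤ garlingSum w p a (A ∪ B) := by
  -- Dropping `R` elements makes room for `A`: ranks in `A ∪ B` do not exceed those in `A'`, so the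
  -- kept terms lose nothing.
  set B := A'.filter fun j => R ≤ rankIn A' j with hB
  have hBA : B ⊆ A' := Finset.filter_subset _ _
  have hdisj : Disjoint A B := Finset.disjoint_left.2 fun i hi hi' =>
    (hlt i hi i (hBA hi')).false
  refine ⟨B, hBA, ?_⟩
  have h1 : garlingSum w p a A = ∑ j ∈ A, ‖a j‖ ^ p * w.val (rankIn (A ∪ B) j) := by
    refine Finset.sum_congr rfl fun j hj => ?_
    have : (A ∪ B).filter (· < j) = A.filter (· < j) := by
      ext i
      simp only [Finset.mem_filter, Finset.mem_union]
      constructor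
      · rintro ⟨hi | hi, hij⟩
        · exact ⟨hi, hij⟩
        · exact absurd hij (hlt j hj i (hBA hi)).not_gt
      · exact fun h => ⟨Or.inl h.1, h.2⟩
    rw [rankIn, rankIn, this]
  have hrank : ∀ j ∈ B, rankIn (A ∪ B) j ≤ rankIn A' j := by
    intro j hj
    have hR : R ≤ rankIn A' j := (Finset.mem_filter.1 hj).2
    have h2 : (B.filter (· < j)).card ≤ rankIn A' j - R := by
      rw [← Nat.card_Ico]
      refine Finset.card_le_card_of_injOn (rankIn A') (fun i hi => ?_)
        ((rankIn_injOn A').mono fun i hi => ?_)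
      · have hi := Finset.mem_filter.1 hi
        rw [Finset.mem_coe, Finset.mem_Ico]
        exact ⟨(Finset.mem_filter.1 hi.1).2, rankIn_lt_rankIn (hBA hi.1) hi.2⟩
      · exact hBA (Finset.mem_filter.1 hi).1
    have h3 : rankIn (A ∪ B) j ≤ A.card + (B.filter (· < j)).card := by
      rw [rankIn, Finset.filter_union]
      exact (Finset.card_union_le _ _).trans (Nat.add_le_add_right
        (Finset.card_le_card (Finset.filter_subset _ _)) _)
    omega
  have h2 : ∑ j ∈ B, ‖a j‖ ^ p * w.val (rankIn A' j) ≤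
      ∑ j ∈ B, ‖a j‖ ^ p * w.val (rankIn (A ∪ B) j) :=
    Finset.sum_le_sum fun j hj => mul_le_mul_of_nonneg_left (w.antitone (hrank j hj))
      (Real.rpow_nonneg (norm_nonneg _) _)
  -- At most `R` terms are dropped, each at most `s / R` because the weights are at most 1.
  have h3 : ∑ j ∈ A' with ¬ R ≤ rankIn A' j, ‖a j‖ ^ p * w.val (rankIn A' j) ≤ s := by
    have hc : (A'.filter fun j => ¬ R ≤ rankIn A' j).card ≤ R := by
      conv_rhs => rw [← Finset.card_range R]
      refine Finset.card_le_card_of_injOn (rankIn A') (fun i hi => ?_)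
        ((rankIn_injOn A').mono (Finset.filter_subset _ _))
      simpa using (Finset.mem_filter.1 hi).2
    rcases Nat.eq_zero_or_pos R with hR | hR
    · simpa [hR] using hs
    · have hR' : (0 : ℝ) < R := Nat.cast_pos.2 hR
      refine (Finset.sum_le_card_nsmul _ _ (s / R) fun j hj => ?_).trans ?_
      · refine (mul_le_of_le_one_right (Real.rpow_nonneg (norm_nonneg _) _)
          (w.val_le_one _)).trans ?_
        rw [le_div_iff₀' hR']
        exact hsmall j (Finset.mem_filter.1 hj).1
      · rw [nsmul_eq_mul]
        calc _ ≤ (R : ℝ) * (s / R) :=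
              mul_le_mul_of_nonneg_right (Nat.cast_le.2 hc) (by positivity)
          _ = s := by field_simp
  have h4 : garlingSum w p a A' = ∑ j ∈ B, ‖a j‖ ^ p * w.val (rankIn A' j) +
      ∑ j ∈ A' with ¬ R ≤ rankIn A' j, ‖a j‖ ^ p * w.val (rankIn A' j) :=
    (Finset.sum_filter_add_sum_filter_not _ _ _).symm
  have h5 : garlingSum w p a (A ∪ B) = ∑ j ∈ A, ‖a j‖ ^ p * w.val (rankIn (A ∪ B) j) +
      ∑ j ∈ B, ‖a j‖ ^ p * w.val (rankIn (A ∪ B) j) := Finset.sum_union hdisj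
  linarith

theorem enorm_rpow_mul_ofReal (hp : 0 ≤ p) (c : 𝕜) (n : ℕ) :
    ‖c‖ₑ ^ p * ENNReal.ofReal (w.val n) = ENNReal.ofReal (‖c‖ ^ p * w.val n) := by
  rw [ENNReal.ofReal_mul (by positivity), ← ofReal_norm,
    ENNReal.ofReal_rpow_of_nonneg (norm_nonneg _) hp]

/-- Together with `garlingENorm_le_of_garlingSum_le`, this makes the `p`-th power of the norm the
supremum of the finite sums `garlingSum`; from here on only finite sets are tested. -/
theorem ofReal_garlingSum_le (hp : 0 < p) (a : ℕ → 𝕜) (A : Finset ℕ) :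
    ENNReal.ofReal (garlingSum w p a A) ≤ garlingENorm w p a ^ p := by
  classical
  -- Adjoining every integer beyond `A` gives an infinite set whose increasing enumeration lists `A`
  -- first.
  let P : ℕ → Prop := fun k => k ∈ A ∨ ∀ i ∈ A, i < k
  have hinf : {k | P k}.Infinite := by
    refine Set.infinite_of_not_bddAbove ?_
    rintro ⟨B, hB⟩
    have : max (B + 1) (A.sup id + 1) ∈ {k | P k} := by
      refine Or.inr fun i hi => ?_
      have : i ≤ A.sup id := Finset.le_sup (f := id) hi
      omega
    have := hB this
    omega
  have hφ : StrictMono (Nat.nth P) := Nat.nth_strictMono hinf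
  have hcount : ∀ j ∈ A, Nat.count P j = rankIn A j := fun j hj => by
    rw [Nat.count_eq_card_filter_range, rankIn]
    congr 1
    ext i
    simp only [Finset.mem_filter, Finset.mem_range, P]
    constructor
    · rintro ⟨hij, hi | hi⟩
      · exact ⟨hi, hij⟩
      · exact absurd hij (hi j hj).not_gt
    · exact fun h => ⟨h.2, Or.inl h.1⟩
  have hnth : ∀ j ∈ A, Nat.nth P (rankIn A j) = j := fun j hj => by
    rw [← hcount j hj]
    exact Nat.nth_count (Or.inl hj)
  rw [← ENNReal.rpow_inv_le_iff hp, ← one_div]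
  refine le_trans ?_ (le_iSup₂ (f := fun (φ : ℕ → ℕ) (_ : StrictMono φ) =>
    (∑' n, ‖a (φ n)‖ₑ ^ p * ENNReal.ofReal (w.val n)) ^ (1 / p)) _ hφ)
  refine ENNReal.rpow_le_rpow ?_ (by positivity)
  refine le_trans (le_of_eq ?_) (ENNReal.sum_le_tsum (A.image (rankIn A)))
  rw [Finset.sum_image (rankIn_injOn A), garlingSum,
    ENNReal.ofReal_sum_of_nonneg fun j _ => garlingSum_term_nonneg w p a j _]
  refine Finset.sum_congr rfl fun j hj => ?_
  rw [hnth j hj, enorm_rpow_mul_ofReal w hp.le]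

theorem garlingENorm_le_of_garlingSum_le (hp : 0 < p) {a : ℕ → 𝕜} {C : ℝ}
    (h : ∀ A, garlingSum w p a A ≤ C) : garlingENorm w p a ≤ ENNReal.ofReal C ^ (1 / p) := by
  refine iSup₂_le fun φ hφ => ENNReal.rpow_le_rpow ?_ (by positivity)
  rw [ENNReal.tsum_eq_iSup_nat]
  refine iSup_le fun m => ?_
  have := h ((Finset.range m).image φ)
  rw [garlingSum_image w hφ, garlingSum_range] at this
  refine le_trans (le_of_eq ?_) (ENNReal.ofReal_le_ofReal this)
  rw [ENNReal.ofReal_sum_of_nonneg fun j _ => garlingSum_term_nonneg w p _ j _]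
  exact Finset.sum_congr rfl fun n _ => enorm_rpow_mul_ofReal w hp.le _ _

end GarlingSum

/-! ### Completeness of the Garling space and subsymmetry of its unit vectors -/

namespace GarlingSpace

variable {𝕜 : Type*} [RCLike 𝕜] {w : GarlingWeight} {p : ℝ} [hp : Fact (1 ≤ p)]

theorem exponent_pos (p : ℝ) [hp : Fact (1 ≤ p)] : 0 < p := zero_lt_one.trans_le hp.out

/-- The coordinates as a linear map. -/
def toSeqLinear (𝕜 : Type*) [RCLike 𝕜] (w : GarlingWeight) (p : ℝ) [hp : Fact (1 ≤ p)] :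
    GarlingSpace 𝕜 w p →ₗ[𝕜] ℕ → 𝕜 := (garlingSubmodule 𝕜 w p).subtype

theorem toSeqLinear_apply (f : GarlingSpace 𝕜 w p) : toSeqLinear 𝕜 w p f = f.toSeq := rfl

theorem toSeq_sub (f g : GarlingSpace 𝕜 w p) : (f - g).toSeq = f.toSeq - g.toSeq := rfl

theorem garlingSum_le_norm_rpow (f : GarlingSpace 𝕜 w p) (A : Finset ℕ) :
    garlingSum w p f.toSeq A ≤ ‖f‖ ^ p := by
  have h := ofReal_garlingSum_le w (exponent_pos p) f.toSeq A
  have hf : garlingENorm w p f.toSeq < ∞ := Subtype.property f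
  have hn : ‖f‖ ^ p = (garlingENorm w p f.toSeq ^ p).toReal := ENNReal.toReal_rpow _ _
  rw [hn]
  exact (ENNReal.ofReal_le_iff_le_toReal
    (ENNReal.rpow_lt_top_of_nonneg (exponent_pos p).le hf.ne).ne).1 h

theorem norm_rpow_le_of_garlingSum_le {f : GarlingSpace 𝕜 w p} {C : ℝ}
    (h : ∀ A, garlingSum w p f.toSeq A ≤ C) : ‖f‖ ^ p ≤ C := by
  have hp0 := exponent_pos p
  have hC : 0 ≤ C := by simpa [garlingSum] using h ∅
  have h1 := garlingENorm_le_of_garlingSum_le w hp0 h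
  rw [one_div, ENNReal.le_rpow_inv_iff hp0] at h1
  have h2 := ENNReal.toReal_mono ENNReal.ofReal_ne_top h1
  rwa [ENNReal.toReal_ofReal hC, ← ENNReal.toReal_rpow] at h2

/-- A sequence with bounded Garling sums, as an element of the Garling space. -/
def ofBound (a : ℕ → 𝕜) {C : ℝ} (h : ∀ A, garlingSum w p a A ≤ C) : GarlingSpace 𝕜 w p :=
  ⟨a, (garlingENorm_le_of_garlingSum_le w (exponent_pos p) h).trans_lt
    (ENNReal.rpow_lt_top_of_nonneg (one_div_nonneg.2 (exponent_pos p).le) ENNReal.ofReal_ne_top)⟩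

theorem norm_toSeq_le (f : GarlingSpace 𝕜 w p) (j : ℕ) : ‖f.toSeq j‖ ≤ ‖f‖ := by
  have hf : garlingENorm w p f.toSeq < ∞ := Subtype.property f
  have := ENNReal.toReal_mono hf.ne (enorm_le_garlingENorm w hp.out f.toSeq j)
  rwa [toReal_enorm] at this

theorem toSeq_linearCombination_unitVec (a : ℕ →₀ 𝕜) :
    (Finsupp.linearCombination 𝕜 (unitVec 𝕜 w p) a).toSeq = a := by
  rw [← toSeqLinear_apply, Finsupp.apply_linearCombination]
  funext j
  rw [Finsupp.linearCombination_apply, Finsupp.sum, Finset.sum_apply]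
  have : ∀ i, (a i • (toSeqLinear 𝕜 w p ∘ unitVec 𝕜 w p) i) j = a i * (Pi.single i 1 : ℕ → 𝕜) j :=
    fun i => rfl
  simp only [this, Pi.single_apply, mul_ite, mul_one, mul_zero]
  rw [Finset.sum_ite_eq]
  split_ifs with h
  · rfl
  · exact (Finsupp.notMem_support_iff.1 h).symm

/-- The Garling space is complete. -/
instance completeSpace : CompleteSpace (GarlingSpace 𝕜 w p) := by
  have hp0 := exponent_pos p
  refine Metric.complete_of_cauchySeq_tendsto fun u hu => ?_
  have hlim : ∀ j, ∃ l, Filter.Tendsto (fun n => (u n).toSeq j) Filter.atTop (nhds l) := by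
    intro j
    refine cauchySeq_tendsto_of_complete (Metric.cauchySeq_iff.2 fun ε hε => ?_)
    obtain ⟨N, hN⟩ := Metric.cauchySeq_iff.1 hu ε hε
    refine ⟨N, fun m hm n hn => lt_of_le_of_lt ?_ (hN m hm n hn)⟩
    rw [dist_eq_norm, dist_eq_norm]
    exact norm_toSeq_le (u m - u n) j
  choose l hl using hlim
  have key : ∀ ε > 0, ∃ N, ∀ n ≥ N, ∀ A, garlingSum w p ((u n).toSeq - l) A ≤ ε ^ p := by
    intro ε hε
    obtain ⟨N, hN⟩ := Metric.cauchySeq_iff.1 hu ε hε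
    refine ⟨N, fun n hn A => ?_⟩
    have ht : Filter.Tendsto (fun m => garlingSum w p ((u n).toSeq - (u m).toSeq) A) Filter.atTop
        (nhds (garlingSum w p ((u n).toSeq - l) A)) := by
      refine tendsto_finsetSum _ fun j _ => Filter.Tendsto.mul_const _ ?_
      exact ((tendsto_const_nhds.sub (hl j)).norm).rpow_const (Or.inr hp0.le)
    refine le_of_tendsto ht (Filter.eventually_atTop.2 ⟨N, fun m hm => ?_⟩)
    refine (garlingSum_le_norm_rpow (u n - u m) A).trans ?_
    refine Real.rpow_le_rpow (norm_nonneg _) ?_ hp0.le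
    rw [← dist_eq_norm]
    exact (hN n hn m hm).le
  obtain ⟨N₁, hN₁⟩ := key 1 one_pos
  -- The coordinatewise limit has finite norm because its difference from one term of the sequence
  -- does.
  let F : GarlingSpace 𝕜 w p := u N₁ - ofBound _ (hN₁ N₁ le_rfl)
  have hF : F.toSeq = l := by
    change (u N₁).toSeq - ((u N₁).toSeq - l) = l
    exact sub_sub_cancel _ _
  refine ⟨F, Metric.tendsto_atTop.2 fun ε hε => ?_⟩
  obtain ⟨N, hN⟩ := key (ε / 2) (half_pos hε)
  refine ⟨N, fun n hn => ?_⟩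
  rw [dist_eq_norm]
  refine lt_of_le_of_lt ?_ (half_lt_self hε)
  rw [← Real.rpow_le_rpow_iff (norm_nonneg _) (half_pos hε).le hp0]
  refine norm_rpow_le_of_garlingSum_le fun A => ?_
  rw [toSeq_sub, hF]
  exact hN n hn A

/-- Infinitely many entries with `p`-th power above `s` would bound `s * ∑ w` by `‖f‖ ^ p`, but the
weights are not summable. -/
theorem exists_forall_rpow_le (f : GarlingSpace 𝕜 w p) {s : ℝ} (hs : 0 < s) :
    ∃ N, ∀ j ≥ N, ‖f.toSeq j‖ ^ p ≤ s := by
  by_contra! hcon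
  obtain ⟨φ, hφ, hφs⟩ := Filter.extraction_of_frequently_atTop (Filter.frequently_atTop.2 hcon)
  refine w.not_summable (summable_of_sum_range_le (c := ‖f‖ ^ p / s) (fun n => (w.pos n).le)
    fun m => ?_)
  rw [le_div_iff₀ hs, Finset.sum_mul]
  refine le_trans ?_ (garlingSum_le_norm_rpow f ((Finset.range m).image φ))
  rw [garlingSum_image w hφ, garlingSum_range]
  refine Finset.sum_le_sum fun n _ => ?_
  rw [mul_comm]
  exact mul_le_mul_of_nonneg_right (hφs n).le (w.pos n).le

/-- Otherwise sets with sum above `ε` occur arbitrarily far out. Since the coordinates tend to zero,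
such sets can be appended one after another with loss at most `ε / 2` each, and the sums become
unbounded. -/
theorem exists_forall_garlingSum_le (f : GarlingSpace 𝕜 w p) {ε : ℝ} (hε : 0 < ε) :
    ∃ N, ∀ A : Finset ℕ, (∀ j ∈ A, N ≤ j) → garlingSum w p f.toSeq A ≤ ε := by
  by_contra! hcon
  have grow : ∀ m : ℕ, ∃ A, m * (ε / 2) ≤ garlingSum w p f.toSeq A := by
    intro m
    induction m with
    | zero => exact ⟨∅, by simp [garlingSum]⟩
    | succ m ih =>
      obtain ⟨A, hA⟩ := ih
      obtain ⟨N, hN⟩ := f.exists_forall_rpow_le (s := ε / 2 / (A.card + 1)) (by positivity)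
      obtain ⟨A', hA'N, hA'⟩ := hcon (max N (A.sup id + 1))
      have hlt : ∀ i ∈ A, ∀ j ∈ A', i < j := fun i hi j hj => by
        have h1 := hA'N j hj
        have h2 : i ≤ A.sup id := Finset.le_sup (f := id) hi
        omega
      have hsmall : ∀ j ∈ A', A.card * ‖f.toSeq j‖ ^ p ≤ ε / 2 := fun j hj => by
        have h1 := hN j ((le_max_left _ _).trans (hA'N j hj))
        rw [le_div_iff₀ (by positivity)] at h1
        have : 0 ≤ ‖f.toSeq j‖ ^ p := by positivity
        linarith
      obtain ⟨B, -, hB⟩ := exists_garlingSum_union_ge w (half_pos hε).le hlt le_rfl hsmall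
      refine ⟨A ∪ B, le_trans ?_ hB⟩
      push_cast
      linarith
  obtain ⟨m, hm⟩ := exists_nat_gt (‖f‖ ^ p / (ε / 2))
  rw [div_lt_iff₀ (half_pos hε)] at hm
  obtain ⟨A, hA⟩ := grow m
  exact absurd (hA.trans (garlingSum_le_norm_rpow f A)) (not_le.2 hm)

/-- Every element is the unconditional sum of its coordinates. -/
theorem hasSum_unitVec (f : GarlingSpace 𝕜 w p) :
    HasSum (fun n => f.toSeq n • unitVec 𝕜 w p n) f := by
  have hp0 := exponent_pos p
  rw [HasSum, SummationFilter.unconditional_filter, Metric.tendsto_atTop]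
  intro ε hε
  obtain ⟨N, hN⟩ := f.exists_forall_garlingSum_le (ε := (ε / 2) ^ p) (by positivity)
  refine ⟨Finset.range N, fun s hs => ?_⟩
  rw [dist_comm, dist_eq_norm]
  refine lt_of_le_of_lt ?_ (half_lt_self hε)
  rw [← Real.rpow_le_rpow_iff (norm_nonneg _) (half_pos hε).le hp0]
  have hseq : (f - ∑ n ∈ s, f.toSeq n • unitVec 𝕜 w p n).toSeq =
      fun j => if j ∈ s then 0 else f.toSeq j := by
    have e : ∑ n ∈ s, f.toSeq n • unitVec 𝕜 w p n =
        Finsupp.linearCombination 𝕜 (unitVec 𝕜 w p) (∑ n ∈ s, Finsupp.single n (f.toSeq n)) := by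
      simp
    rw [e, toSeq_sub, toSeq_linearCombination_unitVec]
    funext j
    rw [Pi.sub_apply, Finsupp.finsetSum_apply]
    simp only [Finsupp.single_apply]
    rw [Finset.sum_ite_eq']
    split_ifs <;> simp
  refine norm_rpow_le_of_garlingSum_le fun A => ?_
  rw [hseq]
  have hsub : A.filter (· ∉ s) ⊆ A := Finset.filter_subset _ _
  refine (garlingSum_le_of_subset w hp0 hsub fun j hj hj' => ?_).trans ?_
  · have : j ∈ s := by
      by_contra h
      exact hj' (Finset.mem_filter.2 ⟨hj, h⟩)
    simp [this]
  · rw [garlingSum_congr w (b := f.toSeq)]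
    · refine hN _ fun j hj => ?_
      by_contra! hjN
      exact (Finset.mem_filter.1 hj).2 (hs (Finset.mem_range.2 hjN))
    · intro j hj
      simp [(Finset.mem_filter.1 hj).2]

/-- The coordinate functionals. -/
def coordFunctional (𝕜 : Type*) [RCLike 𝕜] (w : GarlingWeight) (p : ℝ) [hp : Fact (1 ≤ p)]
    (j : ℕ) : StrongDual 𝕜 (GarlingSpace 𝕜 w p) :=
  LinearMap.mkContinuous ((LinearMap.proj j).comp (toSeqLinear 𝕜 w p)) 1 fun f => by
    rw [one_mul]
    exact norm_toSeq_le f j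

theorem hasSum_unitVec_comp (f : GarlingSpace 𝕜 w p) (σ : Equiv.Perm ℕ) :
    HasSum (fun n => f.toSeq (σ n) • unitVec 𝕜 w p (σ n)) f (SummationFilter.conditional ℕ) :=
  (σ.hasSum_iff.2 (hasSum_unitVec f)).mono_left
    (SummationFilter.conditional ℕ).le_atTop

/-- The coordinate expansion converges unconditionally, so it may be summed in the order given by
`σ`. -/
theorem isBasicSequence_unitVec_comp (σ : Equiv.Perm ℕ) :
    IsBasicSequence 𝕜 (unitVec 𝕜 w p ∘ σ) := by
  classical
  refine ⟨⟨_, fun n => (coordFunctional 𝕜 w p (σ n)).comp (Submodule.subtypeL _),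
    fun i j => ?_, fun f => ?_⟩, rfl⟩
  · change (Pi.single (σ j) 1 : ℕ → 𝕜) (σ i) = _
    simp [Pi.single_apply]
  · rw [HasSum, Topology.IsInducing.subtypeVal.tendsto_nhds_iff]
    have := hasSum_unitVec_comp (f : GarlingSpace 𝕜 w p) σ
    rw [HasSum] at this
    convert! this using 2 with s
    rw [Function.comp, AddSubmonoidClass.coe_finsetSum]
    rfl

variable (𝕜 w p) in
/-- The unit vectors as a Schauder basis of the Garling space. -/
def unitBasis : SchauderBasis 𝕜 (GarlingSpace 𝕜 w p) where
  basis := unitVec 𝕜 w p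
  coord := coordFunctional 𝕜 w p
  ortho i j := by
    change (Pi.single j 1 : ℕ → 𝕜) i = _
    simp [Pi.single_apply]
  expansion f := hasSum_unitVec_comp f (Equiv.refl ℕ)

/-- An increasing map preserves ranks, and test indices outside its range carry zero coefficients,
so they can be dropped. -/
theorem norm_linearCombination_unitVec_comp {φ : ℕ → ℕ} (hφ : StrictMono φ) (a : ℕ →₀ 𝕜) :
    ‖Finsupp.linearCombination 𝕜 (unitVec 𝕜 w p ∘ φ) a‖ =
      ‖Finsupp.linearCombination 𝕜 (unitVec 𝕜 w p) a‖ := by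
  classical
  have hp0 := exponent_pos p
  have hcomp : (Finsupp.mapDomain φ a : ℕ → 𝕜) ∘ φ = a :=
    funext fun n => Finsupp.mapDomain_apply hφ.injective a n
  rw [linearCombination_comp]
  apply le_antisymm
  · rw [← Real.rpow_le_rpow_iff (norm_nonneg _) (norm_nonneg _) hp0]
    refine norm_rpow_le_of_garlingSum_le fun A => ?_
    rw [toSeq_linearCombination_unitVec]
    let B : Finset ℕ := A.preimage φ hφ.injective.injOn
    have hB : B.image φ ⊆ A := Finset.image_subset_iff.2 fun n hn => Finset.mem_preimage.1 hn
    refine (garlingSum_le_of_subset w hp0 hB fun j hj hjB => ?_).trans ?_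
    · refine Finsupp.mapDomain_of_notMem_range _ _ ?_
      rintro ⟨n, rfl⟩
      exact hjB (Finset.mem_image_of_mem _ (Finset.mem_preimage.2 hj))
    · rw [garlingSum_image w hφ, hcomp]
      have := garlingSum_le_norm_rpow (Finsupp.linearCombination 𝕜 (unitVec 𝕜 w p) a) B
      rwa [toSeq_linearCombination_unitVec] at this
  · rw [← Real.rpow_le_rpow_iff (norm_nonneg _) (norm_nonneg _) hp0]
    refine norm_rpow_le_of_garlingSum_le fun A => ?_
    have := garlingSum_le_norm_rpow
      (Finsupp.linearCombination 𝕜 (unitVec 𝕜 w p) (Finsupp.mapDomain φ a)) (A.image φ)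
    rwa [toSeq_linearCombination_unitVec, garlingSum_image w hφ, hcomp,
      ← toSeq_linearCombination_unitVec (w := w) (p := p)] at this

variable (𝕜 w p) in
theorem isSubsymmetricBasis_unitVec : IsSubsymmetricBasis 𝕜 (unitVec 𝕜 w p) := by
  refine ⟨⟨unitBasis 𝕜 w p, rfl⟩, ⟨isBasicSequence_unitVec_comp (Equiv.refl ℕ),
    isBasicSequence_unitVec_comp⟩, fun φ hφ => ⟨1, one_pos, fun a => ?_, fun a => ?_⟩⟩
  · rw [one_mul]
    exact (norm_linearCombination_unitVec_comp hφ a).ge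
  · rw [one_mul]
    exact (norm_linearCombination_unitVec_comp hφ a).le

end GarlingSpace

/-! ### Block sequences of the unit vectors and `ℓ_p` -/

namespace GarlingSpace

variable {𝕜 : Type*} [RCLike 𝕜] {w : GarlingWeight} {p : ℝ} [hp : Fact (1 ≤ p)]

/-- Block sequences of the unit vectors satisfy an upper `ℓ_p` estimate. -/
theorem norm_rpow_blocks_le {M : ℕ → ℕ} {δ : ℕ → ℕ →₀ 𝕜} (hδ : IsBlockSequence M δ) {D : ℝ}
    (hD : ∀ n, ‖Finsupp.linearCombination 𝕜 (unitVec 𝕜 w p) (δ n)‖ ≤ D) (a : ℕ →₀ 𝕜) :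
    ‖Finsupp.linearCombination 𝕜
      (fun n => Finsupp.linearCombination 𝕜 (unitVec 𝕜 w p) (δ n)) a‖ ^ p ≤
      D ^ p * lpSum p a := by
  have hp0 := exponent_pos p
  rw [linearCombination_blocks]
  refine norm_rpow_le_of_garlingSum_le fun A => ?_
  rw [toSeq_linearCombination_unitVec]
  have hterm : ∀ j, ‖Finsupp.linearCombination 𝕜 δ a j‖ ^ p ≤
      ∑ n ∈ a.support, ‖a n‖ ^ p * ‖δ n j‖ ^ p := by
    intro j
    have hnn : ∀ n ∈ a.support, 0 ≤ ‖a n‖ ^ p * ‖δ n j‖ ^ p := fun n _ => by positivity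
    by_cases h0 : Finsupp.linearCombination 𝕜 δ a j = 0
    · rw [h0, norm_zero, Real.zero_rpow hp0.ne']
      exact Finset.sum_nonneg hnn
    · obtain ⟨n, hn, hj⟩ := hδ.exists_mem_of_ne_zero a h0
      rw [hδ.linearCombination_apply a hj, norm_mul,
        Real.mul_rpow (norm_nonneg _) (norm_nonneg _)]
      exact Finset.single_le_sum (f := fun n => ‖a n‖ ^ p * ‖δ n j‖ ^ p) hnn hn
  -- The same test set `A` is used for every block, so each block contributes at most `D ^ p` times
  -- the power of its coefficient.
  calc garlingSum w p (Finsupp.linearCombination 𝕜 δ a) A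
      ≤ ∑ j ∈ A, ∑ n ∈ a.support, ‖a n‖ ^ p * (‖δ n j‖ ^ p * w.val (rankIn A j)) := by
        refine Finset.sum_le_sum fun j _ => ?_
        refine (mul_le_mul_of_nonneg_right (hterm j) (w.pos _).le).trans_eq ?_
        rw [Finset.sum_mul]
        simp only [mul_assoc]
    _ = ∑ n ∈ a.support, ‖a n‖ ^ p * garlingSum w p (δ n) A := by
        rw [Finset.sum_comm]
        simp only [garlingSum, Finset.mul_sum]
    _ ≤ ∑ n ∈ a.support, ‖a n‖ ^ p * D ^ p := by
        refine Finset.sum_le_sum fun n _ => mul_le_mul_of_nonneg_left ?_ (by positivity)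
        have := garlingSum_le_norm_rpow (Finsupp.linearCombination 𝕜 (unitVec 𝕜 w p) (δ n)) A
        rw [toSeq_linearCombination_unitVec] at this
        exact this.trans (Real.rpow_le_rpow (norm_nonneg _) (hD n) hp0.le)
    _ = D ^ p * lpSum p a := by rw [← Finset.sum_mul, mul_comm]; rfl

/-- A seminormalized block sequence of the unit vectors whose coefficients tend uniformly to zero
has a subsequence equivalent to the `ℓ_p` basis. -/
theorem exists_subseq_isLpSequence {M : ℕ → ℕ} {δ : ℕ → ℕ →₀ 𝕜} (hδ : IsBlockSequence M δ)
    (hsn : Seminormalized fun n => Finsupp.linearCombination 𝕜 (unitVec 𝕜 w p) (δ n))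
    (hnull : ∀ c > 0, ∀ᶠ n in Filter.atTop, ∀ j, ‖δ n j‖ < c) :
    ∃ ψ : ℕ → ℕ, StrictMono ψ ∧ IsLpSequence 𝕜 p
      ((fun n => Finsupp.linearCombination 𝕜 (unitVec 𝕜 w p) (δ n)) ∘ ψ) := by
  have hp0 := exponent_pos p
  obtain ⟨c, D, hc, hD, hsn⟩ := hsn
  have hcp : 0 < c ^ p := Real.rpow_pos_of_pos hc p
  have hDp : 0 < D ^ p := Real.rpow_pos_of_pos hD p
  have hA : ∀ n, ∃ A : Finset ℕ, (∀ j ∈ A, M n ≤ j ∧ j < M (n + 1)) ∧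
      c ^ p / 2 ≤ garlingSum w p (δ n) A := by
    intro n
    have : ∃ A, c ^ p / 2 < garlingSum w p (δ n) A := by
      by_contra! hcon
      rw [← toSeq_linearCombination_unitVec (w := w) (p := p)] at hcon
      have h1 := norm_rpow_le_of_garlingSum_le hcon
      have h2 := Real.rpow_le_rpow hc.le (hsn n).1 hp0.le
      linarith
    obtain ⟨A, hA⟩ := this
    refine ⟨A.filter (δ n · ≠ 0), fun j hj => hδ.2 n j (Finset.mem_filter.1 hj).2,
      hA.le.trans (garlingSum_le_of_subset w hp0 (Finset.filter_subset _ _) fun j hj hj' => ?_)⟩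
    by_contra h0
    exact hj' (Finset.mem_filter.2 ⟨hj, h0⟩)
  choose A hAM hA using hA
  -- Here `R` bounds the number of indices already used. Of the `c ^ p / 2` captured by the next
  -- test set, appending then loses at most `c ^ p / 4`, which leaves the constant `4 / c ^ p`.
  have step : ∀ m R : ℕ, ∃ m', m < m' ∧ ∀ j, R * ‖δ m' j‖ ^ p ≤ c ^ p / 4 := by
    intro m R
    obtain ⟨m', h1, h2⟩ := ((hnull ((c ^ p / 4 / (R + 1)) ^ (1 / p)) (by positivity)).and
      (Filter.eventually_gt_atTop m)).exists
    refine ⟨m', h2, fun j => ?_⟩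
    have h3 := Real.rpow_le_rpow (norm_nonneg _) (h1 j).le hp0.le
    rw [← Real.rpow_mul (by positivity), one_div_mul_cancel hp0.ne', Real.rpow_one,
      le_div_iff₀ (by positivity)] at h3
    have : 0 ≤ ‖δ m' j‖ ^ p := by positivity
    linarith
  choose next hnext using step
  -- The state is (last chosen index, total size of the chosen test sets). The initial index 0 is a
  -- dummy, hence the shift in `ψ`.
  let st : ℕ → ℕ × ℕ := fun n =>
    Nat.rec (0, 0) (fun _ s => (next s.1 s.2, s.2 + (A (next s.1 s.2)).card)) n
  let ψ : ℕ → ℕ := fun n => (st (n + 1)).1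
  let R : ℕ → ℕ := fun n => (st n).2
  have hψ : StrictMono ψ := strictMono_nat_of_lt_succ fun n => (hnext (ψ n) (R (n + 1))).1
  have hR : ∀ n, R (n + 1) = R n + (A (ψ n)).card := fun n => rfl
  have hsmall : ∀ n j, R n * ‖δ (ψ n) j‖ ^ p ≤ c ^ p / 4 := fun n => (hnext (st n).1 (R n)).2
  refine ⟨ψ, hψ, max (4 / c ^ p) (D ^ p), by positivity, fun a => ⟨?_, ?_⟩⟩
  · set F : ℕ →₀ 𝕜 := Finsupp.linearCombination 𝕜 δ (Finsupp.mapDomain ψ a) with hF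
    have hFval : ∀ n, ∀ j ∈ A (ψ n), F j = a n * δ (ψ n) j := fun n j hj => by
      rw [hF, hδ.linearCombination_apply _ (hAM _ j hj), Finsupp.mapDomain_apply hψ.injective]
    have build : ∀ m, ∃ U : Finset ℕ, (∀ j ∈ U, j < M (ψ m)) ∧ U.card ≤ R m ∧
        c ^ p / 4 * ∑ n ∈ Finset.range m, ‖a n‖ ^ p ≤ garlingSum w p F U := by
      intro m
      induction m with
      | zero => exact ⟨∅, by simp, by simp, by simp [garlingSum]⟩
      | succ m ih =>
        obtain ⟨U, hU, hUR, hUsum⟩ := ih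
        have ham : 0 ≤ ‖a m‖ ^ p := by positivity
        obtain ⟨B, hB, hBsum⟩ := exists_garlingSum_union_ge w (a := F) (p := p) (A := U)
          (A' := A (ψ m)) (R := R m) (s := ‖a m‖ ^ p * (c ^ p / 4)) (by positivity)
          (fun i hi j hj => (hU i hi).trans_le (hAM _ j hj).1) hUR fun j hj => by
            rw [hFval m j hj, norm_mul, Real.mul_rpow (norm_nonneg _) (norm_nonneg _),
              mul_left_comm]
            exact mul_le_mul_of_nonneg_left (hsmall m j) ham
        refine ⟨U ∪ B, fun j hj => ?_, ?_, ?_⟩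
        · rcases Finset.mem_union.1 hj with h | h
          · exact (hU j h).trans_le (hδ.1.monotone (hψ.monotone m.le_succ))
          · exact (hAM _ j (hB h)).2.trans_le (hδ.1.monotone (hψ m.lt_succ_self))
        · rw [hR]
          exact (Finset.card_union_le _ _).trans (add_le_add hUR (Finset.card_le_card hB))
        · have h1 : garlingSum w p F (A (ψ m)) = ‖a m‖ ^ p * garlingSum w p (δ (ψ m)) (A (ψ m)) := by
            rw [garlingSum, garlingSum, Finset.mul_sum]
            refine Finset.sum_congr rfl fun j hj => ?_
            rw [hFval m j hj, norm_mul, Real.mul_rpow (norm_nonneg _) (norm_nonneg _), mul_assoc]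
          have h2 := mul_le_mul_of_nonneg_left (hA (ψ m)) ham
          rw [Finset.sum_range_succ, mul_add]
          linarith
    obtain ⟨m, hm⟩ := a.support.exists_nat_subset_range
    obtain ⟨U, -, -, hU⟩ := build m
    rw [linearCombination_comp, linearCombination_blocks, ← hF]
    have h1 := garlingSum_le_norm_rpow (Finsupp.linearCombination 𝕜 (unitVec 𝕜 w p) F) U
    rw [toSeq_linearCombination_unitVec] at h1
    have h2 : lpSum p a ≤ ∑ n ∈ Finset.range m, ‖a n‖ ^ p :=
      Finset.sum_le_sum_of_subset_of_nonneg hm fun n _ _ => by positivity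
    have h3 : lpSum p a ≤
        4 / c ^ p * ‖Finsupp.linearCombination 𝕜 (unitVec 𝕜 w p) F‖ ^ p := by
      rw [div_mul_eq_mul_div, le_div_iff₀ hcp]
      have := mul_le_mul_of_nonneg_right h2 hcp.le
      linarith
    exact h3.trans (mul_le_mul_of_nonneg_right (le_max_left _ _) (by positivity))
  · rw [linearCombination_comp]
    refine (norm_rpow_blocks_le hδ (fun n => (hsn n).2) _).trans ?_
    rw [lpSum_mapDomain p hψ.injective]
    exact mul_le_mul_of_nonneg_right (le_max_right _ _) (lpSum_nonneg p a)

end GarlingSpace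

/-! ### Subsymmetric bases of subspaces of Garling spaces -/

section Uniqueness

variable {𝕜 : Type*} [RCLike 𝕜]
variable {X : Type*} [NormedAddCommGroup X] [NormedSpace 𝕜 X]
variable {Y : Type*} [NormedAddCommGroup Y] [NormedSpace 𝕜 Y]

variable (𝕜) in
/-- The inequalities satisfied by a subsymmetric basic sequence in a Banach space. -/
structure HasSubsymmetricEstimates (x : ℕ → X) : Prop where
  unconditional : ∃ K : ℝ, 0 < K ∧ UnconditionalWith 𝕜 K x
  seminormalized : Seminormalized x
  subsequence : ∀ φ : ℕ → ℕ, StrictMono φ → AreEquivalent 𝕜 x (x ∘ φ)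

theorem IsSubsymmetricBasic.hasSubsymmetricEstimates [CompleteSpace X] {x : ℕ → X}
    (h : IsSubsymmetricBasic 𝕜 x) : HasSubsymmetricEstimates 𝕜 x :=
  ⟨h.1.exists_unconditionalWith, seminormalized_of_subsequences h.1.1.ne_zero h.2, h.2⟩

theorem areEquivalent_of_norm_eq {x : ℕ → X} {y : ℕ → Y}
    (h : ∀ a : ℕ →₀ 𝕜,
      ‖Finsupp.linearCombination 𝕜 x a‖ = ‖Finsupp.linearCombination 𝕜 y a‖) :
    AreEquivalent 𝕜 x y :=
  ⟨1, one_pos, fun a => by rw [one_mul]; exact (h a).le,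
    fun a => by rw [one_mul]; exact (h a).ge⟩

theorem HasSubsymmetricEstimates.of_norm_eq {x : ℕ → X} {y : ℕ → Y}
    (hx : HasSubsymmetricEstimates 𝕜 x)
    (h : ∀ a : ℕ →₀ 𝕜,
      ‖Finsupp.linearCombination 𝕜 x a‖ = ‖Finsupp.linearCombination 𝕜 y a‖) :
    HasSubsymmetricEstimates 𝕜 y := by
  have heq := areEquivalent_of_norm_eq h
  obtain ⟨K, hK, hu⟩ := hx.unconditional
  exact ⟨⟨K, hK, fun a b hab => by rw [← h, ← h]; exact hu a b hab⟩,
    hx.seminormalized.of_areEquivalent heq,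
    fun φ hφ => heq.symm.trans ((hx.subsequence φ hφ).trans (heq.comp φ))⟩

theorem HasSubsymmetricEstimates.exists_equivalent_blocks {x : ℕ → X}
    (h : HasSubsymmetricEstimates 𝕜 x) (b : SchauderBasis 𝕜 X) :
    ∃ (N : ℕ → ℕ) (β : ℕ → ℕ →₀ 𝕜), IsBlockSequence N β ∧
      AreEquivalent 𝕜 x (fun n => Finsupp.linearCombination 𝕜 b.basis (β n)) := by
  obtain ⟨K, hK, hu⟩ := h.unconditional
  exact b.exists_equivalent_blocks hK hu h.seminormalized h.subsequence

/-- A block sequence whose coefficients do not tend uniformly to zero has a subsequence that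
dominates a subsequence of the underlying unconditional sequence. -/
theorem UnconditionalWith.exists_dominates_of_blocks {K : ℝ} (hK : 0 < K) {x : ℕ → X}
    (hx : UnconditionalWith 𝕜 K x) {N : ℕ → ℕ} {β : ℕ → ℕ →₀ 𝕜} (hβ : IsBlockSequence N β)
    {c : ℝ} (hc : 0 < c) (hfreq : ∃ᶠ n in Filter.atTop, ∃ k, c ≤ ‖β n k‖) :
    ∃ φ κ : ℕ → ℕ, StrictMono φ ∧ StrictMono κ ∧
      Dominates 𝕜 ((fun n => Finsupp.linearCombination 𝕜 x (β n)) ∘ φ) (x ∘ κ) := by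
  obtain ⟨φ, hφ, h⟩ := Filter.extraction_of_frequently_atTop hfreq
  choose κ hκ using h
  have hmem : ∀ n, N (φ n) ≤ κ n ∧ κ n < N (φ n + 1) := fun n => hβ.2 _ _ fun h0 => by
    have := hκ n
    rw [h0, norm_zero] at this
    linarith
  have hκm : StrictMono κ := strictMono_nat_of_lt_succ fun n =>
    (hmem n).2.trans_le ((hβ.1.monotone (hφ n.lt_succ_self)).trans (hmem (n + 1)).1)
  refine ⟨φ, κ, hφ, hκm, K * c⁻¹, by positivity, fun a => ?_⟩
  rw [linearCombination_comp, linearCombination_comp, linearCombination_blocks]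
  have := hx (Finsupp.mapDomain κ a)
    -- After scaling by `c⁻¹`, the coefficient at the chosen position `κ n` has modulus at least `‖a
    -- n‖`.
    (((c⁻¹ : ℝ) : 𝕜) • Finsupp.linearCombination 𝕜 β (Finsupp.mapDomain φ a)) fun k => ?_
  · rw [map_smul, norm_smul, RCLike.norm_ofReal, abs_of_pos (inv_pos.2 hc)] at this
    rwa [mul_assoc]
  · by_cases hk : ∃ n, κ n = k
    · obtain ⟨n, rfl⟩ := hk
      rw [Finsupp.mapDomain_apply hκm.injective, Finsupp.smul_apply,
        hβ.linearCombination_apply _ (hmem n), Finsupp.mapDomain_apply hφ.injective, norm_smul,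
        norm_mul, RCLike.norm_ofReal, abs_of_pos (inv_pos.2 hc)]
      have h1 : 1 ≤ c⁻¹ * ‖β (φ n) (κ n)‖ := by
        rw [inv_mul_eq_div, one_le_div hc]
        exact hκ n
      calc ‖a n‖ ≤ ‖a n‖ * (c⁻¹ * ‖β (φ n) (κ n)‖) := le_mul_of_one_le_right (norm_nonneg _) h1
        _ = _ := by ring
    · rw [Finsupp.mapDomain_of_notMem_range _ _ fun h => hk h, norm_zero]
      exact norm_nonneg _

variable {w : GarlingWeight} {p : ℝ} [hp : Fact (1 ≤ p)]

theorem norm_linearCombination_linearIsometry (ι : Y →ₗᵢ[𝕜] X) (z : ℕ → Y) (a : ℕ →₀ 𝕜) :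
    ‖Finsupp.linearCombination 𝕜 z a‖ = ‖Finsupp.linearCombination 𝕜 (ι ∘ z) a‖ := by
  rw [← ι.norm_map (Finsupp.linearCombination 𝕜 z a)]
  exact congrArg norm (Finsupp.apply_linearCombination 𝕜 ι.toLinearMap z a)

/-- In a subspace of a Garling space, a subsymmetric basic sequence dominates a given subsymmetric
basis, unless it is equivalent to the `ℓ_p` basis. -/
theorem HasSubsymmetricEstimates.dominates_or_isLpSequence
    (ι : Y →ₗᵢ[𝕜] GarlingSpace 𝕜 w p) {x y : ℕ → Y} (hx : HasSubsymmetricEstimates 𝕜 x)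
    (hb : IsSchauderBasis 𝕜 x) (hy : HasSubsymmetricEstimates 𝕜 y) :
    Dominates 𝕜 y x ∨ IsLpSequence 𝕜 p y := by
  have hp0 := GarlingSpace.exponent_pos p
  obtain ⟨b, rfl⟩ := hb
  obtain ⟨K, hK, hu⟩ := hx.unconditional
  obtain ⟨N, β, hβ, hyβ⟩ := hy.exists_equivalent_blocks b
  by_cases hcase : ∃ c : ℝ, 0 < c ∧ ∃ᶠ n in Filter.atTop, ∃ k, c ≤ ‖β n k‖
  · left
    obtain ⟨c, hc, hfreq⟩ := hcase
    obtain ⟨φ, κ, hφ, hκ, hdom⟩ := hu.exists_dominates_of_blocks hK hβ hc hfreq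
    have h1 := (areEquivalent_iff_dominates.1 ((hy.subsequence φ hφ).trans (hyβ.comp φ))).2
    exact (h1.trans hdom).trans (areEquivalent_iff_dominates.1 (hx.subsequence κ hκ)).1
  · right
    -- The coefficients of `y` over `x` are uniformly null. Those of `x` over the unit vectors are
    -- bounded by `D`, so the composed blocks are uniformly null as well.
    have hι := norm_linearCombination_linearIsometry ι b.basis
    obtain ⟨M, γ, hγ, hιγ⟩ :=
      (hx.of_norm_eq hι).exists_equivalent_blocks (GarlingSpace.unitBasis 𝕜 w p)
    have hxγ := (areEquivalent_of_norm_eq hι).trans hιγ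
    have hγsn := hx.seminormalized.of_areEquivalent hxγ
    obtain ⟨_, D, _, hD, hγD⟩ := hγsn
    have hγle : ∀ k j, ‖γ k j‖ ≤ D := fun k j => by
      refine le_trans ?_ (hγD k).2
      have := GarlingSpace.norm_toSeq_le
        (Finsupp.linearCombination 𝕜 (GarlingSpace.unitVec 𝕜 w p) (γ k)) j
      rwa [GarlingSpace.toSeq_linearCombination_unitVec] at this
    have hyv := hyβ.trans (hxγ.blocks β)
    simp only [linearCombination_blocks] at hyv
    obtain ⟨ψ, hψ, hlp⟩ := GarlingSpace.exists_subseq_isLpSequence (hβ.blocks hγ)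
      (hy.seminormalized.of_areEquivalent hyv) fun c hc => by
        have hev : ∀ᶠ n in Filter.atTop, ∀ k, ‖β n k‖ < c / D := by
          by_contra hcon
          refine hcase ⟨c / D, by positivity, ?_⟩
          rw [Filter.not_eventually] at hcon
          exact hcon.mono fun n hn => by simpa using hn
        filter_upwards [hev] with n hn j
        by_cases h0 : Finsupp.linearCombination 𝕜 γ (β n) j = 0
        · rwa [h0, norm_zero]
        · obtain ⟨k, -, hj⟩ := hγ.exists_mem_of_ne_zero _ h0
          rw [hγ.linearCombination_apply _ hj, norm_mul]
          calc ‖β n k‖ * ‖γ k j‖ ≤ ‖β n k‖ * D :=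
                mul_le_mul_of_nonneg_left (hγle k j) (norm_nonneg _)
            _ < c / D * D := mul_lt_mul_of_pos_right (hn k) hD
            _ = c := div_mul_cancel₀ c hD.ne'
    exact hlp.of_areEquivalent hp0 ((hy.subsequence ψ hψ).trans (hyv.comp ψ)).symm

/-- The `ℓ_p` alternative passes from one basis to the other, since `y` is equivalent to a
seminormalized block sequence of `x`. -/
theorem HasSubsymmetricEstimates.isLpSequence {x y : ℕ → Y}
    (hx : IsSchauderBasis 𝕜 x) (hlp : IsLpSequence 𝕜 p x) (hy : HasSubsymmetricEstimates 𝕜 y) :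
    IsLpSequence 𝕜 p y := by
  have hp0 := GarlingSpace.exponent_pos p
  obtain ⟨b, rfl⟩ := hx
  obtain ⟨N, β, hβ, hyβ⟩ := hy.exists_equivalent_blocks b
  exact (hlp.blocks hp0 hβ (hy.seminormalized.of_areEquivalent hyβ)).of_areEquivalent hp0 hyβ.symm

/-- Subspaces of Garling spaces have at most one subsymmetric basis. -/
theorem HasSubsymmetricEstimates.areEquivalent (ι : Y →ₗᵢ[𝕜] GarlingSpace 𝕜 w p)
    {x y : ℕ → Y} (hbx : IsSchauderBasis 𝕜 x) (hx : HasSubsymmetricEstimates 𝕜 x)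
    (hby : IsSchauderBasis 𝕜 y) (hy : HasSubsymmetricEstimates 𝕜 y) :
    AreEquivalent 𝕜 x y := by
  have hp0 := GarlingSpace.exponent_pos p
  have of_lp : IsLpSequence 𝕜 p x → IsLpSequence 𝕜 p y → AreEquivalent 𝕜 x y := fun h1 h2 =>
    areEquivalent_iff_dominates.2 ⟨h2.dominates hp0 h1, h1.dominates hp0 h2⟩
  rcases hx.dominates_or_isLpSequence ι hbx hy with h1 | h1
  · rcases hy.dominates_or_isLpSequence ι hby hx with h2 | h2
    · exact areEquivalent_iff_dominates.2 ⟨h1, h2⟩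
    · exact of_lp h2 (hy.isLpSequence hbx h2)
  · exact of_lp (hx.isLpSequence hby h1) h1

end Uniqueness

theorem mainTheorem2 {𝕜 : Type*} [RCLike 𝕜] (p : ℝ) [Fact (1 ≤ p)] (w : GarlingWeight) :
    (∀ y : ℕ → GarlingSpace 𝕜 w p, IsSubsymmetricBasic 𝕜 y →
      ∀ u : ℕ → closedSpan 𝕜 y, IsSubsymmetricBasis 𝕜 u → AreEquivalent 𝕜 u y) ∧
    IsSubsymmetricBasis 𝕜 (GarlingSpace.unitVec 𝕜 w p) ∧
    (∀ u : ℕ → GarlingSpace 𝕜 w p, IsSubsymmetricBasis 𝕜 u →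
      AreEquivalent 𝕜 u (GarlingSpace.unitVec 𝕜 w p)) := by
  have he := GarlingSpace.isSubsymmetricBasis_unitVec 𝕜 w p
  refine ⟨fun y hy u hu => ?_, he, fun u hu => ?_⟩
  -- Both bases are compared inside the closed span, whose inclusion is the isometry required; `hn`
  -- then returns to the ambient space.
  · have hn := norm_linearCombination_closedSpan (𝕜 := 𝕜) y
    exact (HasSubsymmetricEstimates.areEquivalent (closedSpan 𝕜 y).subtypeₗᵢ hu.1
      hu.2.hasSubsymmetricEstimates hy.1.1
      (hy.hasSubsymmetricEstimates.of_norm_eq fun a => (hn a).symm)).trans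
      (areEquivalent_of_norm_eq hn)
  · exact HasSubsymmetricEstimates.areEquivalent LinearIsometry.id hu.1
      hu.2.hasSubsymmetricEstimates he.1 he.2.hasSubsymmetricEstimates

end
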